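/- Let $\Theta$ and $\mathsf Y$ be metric spaces with their Borel $\sigma$-algebras, let ${\rm d}\theta$ be a $\sigma$-finite measure on $\Theta$, $p:\Theta\to[0,\infty)$ a measurable prior density, $q(\theta,\cdot)$ ($\theta\in\Theta$) jointly measurable probability densities with respect to ${\rm d}\theta$ (the proposal), $\{f_\theta\}_{\theta\in\Theta}$ a measurable family of probability distributions on $\mathsf Y$ (the likelihoods), $y\in\mathsf Y$ the data and $\epsilon$ a real tolerance. Let $B_{\epsilon,x}=\{x':d(x,x')\le\epsilon\}$, $w(x)=I(y\in B_{\epsilon,x})$, $h(\theta)=f_\theta(B_{\epsilon,y})$, $H=\int_\Theta p(\theta)h(\theta)\,{\rm d}\theta$ and $c(\theta,\vartheta)=p(\theta)q(\theta,\vartheta)$. One iteration of the 1-hit algorithm from the state $\theta$ is as follows. (1) Sample $\vartheta\sim q(\theta,\cdot)$. (2) With probability $1-\{1\wedge c(\vartheta,\theta)/c(\theta,\vartheta)\}$, stop and output $\theta$; then put $N=0$. (3) Otherwise, for $i=1,2,\ldots$ sample independently $x_i\sim f_\theta$ and $z_i\sim f_\vartheta$ until $\sum_{j=1}^i\{w(z_j)+w(x_j)\}\ge1$,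 and let $N$ be the last $i$ ($N=\infty$, with output $\theta$, if this never stops). (4) If $w(z_N)=1$, output $\vartheta$; otherwise output $\theta$. Let $P_3(\theta,\cdot)$ be the law of the output. Suppose that the prior is proper, $\int_\Theta p(\theta)\,{\rm d}\theta=1$, that $H>0$, and that $P_3$ is irreducible on $S=\{\theta:p(\theta)h(\theta)>0\}$: there is a nonzero $\sigma$-finite measure $\varphi$ on $\Theta$ such that for every measurable $A$ with $\varphi(A)>0$ and every $\theta\in S$ there is an $m\ge0$ with $P_3^m(\theta,A)>0$ (this holds in particular if $P_3$ is $\varphi$-irreducible on all of $\Theta$). Then there is a deterministic constant $n$ such that, for every initial distribution on $\Theta$ that gives probability one to $S$ (in particular for every fixed starting point in $S$, and for the approximate posterior $\pi\propto ph$), if the algorithm is iterated and $N_i$ is the value of $N$ at iteration $i$, then almost surely $$\lim_{m\to\infty}\frac1m\sum_{i=1}^m N_i=n,\qquad\text{and}\qquad n\le H^{-1}<\infty .$$ Moreover $H^{-1}=n_R$, where $n_R$ is the expected number of proposals of the rejection sampler, which draws independent pairs $(\theta_j,x_j)$ with $\theta_j\sim p$ and $x_j\sim f_{\theta_j}$,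 $j=1,2,\ldots$, until $w(x_j)=1$; hence $n\le n_R$. -/

import Mathlib

open MeasureTheory ProbabilityTheory Filter Topology
open scoped ENNReal NNReal

/-- The first time `i ∈ {1, 2, …}` at which an event happens, `⊤` if it never happens. The event
at time `i` is `b (i - 1)`. -/
noncomputable def firstTime (b : ℕ → Prop) : ℕ∞ :=
  ⨅ (i : ℕ) (_ : b i), ((i : ℕ∞) + 1)

theorem measurable_firstTime {α : Type*} [MeasurableSpace α] {b : α → ℕ → Prop}
    (hb : ∀ i, MeasurableSet {a | b a i}) : Measurable fun a => firstTime (b a) := by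
  classical
  have h : (fun a => firstTime (b a)) =
      fun a => ⨅ i : ℕ, if b a i then ((i : ℕ∞) + 1) else ⊤ := by
    funext a
    simp only [firstTime, iInf_eq_if]
  have : BorelSpace ℕ∞ := ⟨borel_eq_top_of_countable.symm⟩
  rw [h]
  exact Measurable.iInf fun i => Measurable.ite (hb i) measurable_const measurable_const

/-- The kernel that draws an infinite i.i.d. sequence from `κ a`. -/
noncomputable def iidKernel {α β : Type*} [MeasurableSpace α] [MeasurableSpace β]
    (κ : Kernel α β) [IsMarkovKernel κ] : Kernel α (ℕ → β) where
  toFun a := Measure.infinitePi fun _ : ℕ => κ a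
  measurable' := by
    refine Measurable.measure_of_isPiSystem_of_isProbabilityMeasure
      (generateFrom_squareCylinders (α := fun _ : ℕ => β)).symm
      (isPiSystem_squareCylinders (fun _ => MeasurableSpace.isPiSystem_measurableSet)
        (by simp)) ?_
    rintro s ⟨J, t, ht, rfl⟩
    have ht' : ∀ i, MeasurableSet (t i) := fun i => ht i (Set.mem_univ i)
    simp_rw [fun a => Measure.infinitePi_pi (fun _ : ℕ => κ a) (s := J) (fun i _ => ht' i)]
    exact Finset.measurable_prod _ fun i _ => κ.measurable_coe (ht' i)

instance {α β : Type*} [MeasurableSpace α] [MeasurableSpace β]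
    (κ : Kernel α β) [IsMarkovKernel κ] : IsMarkovKernel (iidKernel κ) :=
  ⟨fun a => inferInstanceAs (IsProbabilityMeasure (Measure.infinitePi fun _ : ℕ => κ a))⟩

/-- `κ` is irreducible on the set `S` of states: there is a nonzero σ-finite measure `φ` such that
every measurable set of positive `φ`-measure is reached with positive probability from every
state in `S`. -/
def IsIrreducibleOn {α : Type*} [MeasurableSpace α] (S : Set α) (κ : Kernel α α) : Prop :=
  ∃ φ : Measure α, SigmaFinite φ ∧ φ ≠ 0 ∧
    ∀ A, MeasurableSet A → 0 < φ A → ∀ a ∈ S, ∃ n : ℕ, 0 < (κ ^ n) a A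

/-- The data of approximate Bayesian computation with a Metropolis–Hastings type proposal. The
prior is allowed to be improper. -/
structure ABCModel (Θ Y : Type*) [MeasurableSpace Θ] [MetricSpace Y] [MeasurableSpace Y] where
  /-- the common dominating measure on the parameter space -/
  base : Measure Θ
  sigmaFinite_base : SigmaFinite base
  /-- the prior density -/
  p : Θ → ℝ≥0
  measurable_p : Measurable p
  /-- the proposal densities, `q θ` being the density of the proposal from `θ` -/
  q : Θ → Θ → ℝ≥0
  measurable_q : Measurable (Function.uncurry q)
  lintegral_q : ∀ θ, ∫⁻ ϑ, (q θ ϑ : ℝ≥0∞) ∂base = 1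
  /-- the likelihoods, as probability distributions on the data space -/
  f : Kernel Θ Y
  isMarkovKernel_f : IsMarkovKernel f
  /-- the tolerance -/
  ε : ℝ
  /-- the observed data -/
  y : Y

namespace ABCModel

attribute [instance] sigmaFinite_base isMarkovKernel_f

section Basic

variable {Θ Y : Type*} [MeasurableSpace Θ] [MetricSpace Y] [MeasurableSpace Y]

/-- The prior distribution. -/
noncomputable def prior (M : ABCModel Θ Y) : Measure Θ :=
  M.base.withDensity fun θ => (M.p θ : ℝ≥0∞)

/-- The proposal kernel `q(θ, dϑ)`. -/
noncomputable def proposal (M : ABCModel Θ Y) : Kernel Θ Θ :=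
  (Kernel.const Θ M.base).withDensity fun θ ϑ => (M.q θ ϑ : ℝ≥0∞)

instance (M : ABCModel Θ Y) : IsMarkovKernel M.proposal := by
  refine ⟨fun θ => ⟨?_⟩⟩
  have hm : Measurable (Function.uncurry fun θ ϑ => (M.q θ ϑ : ℝ≥0∞)) :=
    M.measurable_q.coe_nnreal_ennreal
  rw [proposal, Kernel.withDensity_apply' _ hm]
  simpa using M.lintegral_q θ

/-- The data `x` is a hit, that is, `w(x) = 1`: the observed data are in the ball around `x`. -/
def Hit (M : ABCModel Θ Y) (x : Y) : Prop := M.y ∈ Metric.closedBall x M.ε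

/-- The probability `h(θ)` of hitting the ball around the observed data with a draw from the
likelihood of `θ`. -/
noncomputable def h (M : ABCModel Θ Y) (θ : Θ) : ℝ≥0∞ := M.f θ (Metric.closedBall M.y M.ε)

/-- The normalizing constant of the approximate posterior. -/
noncomputable def H (M : ABCModel Θ Y) : ℝ≥0∞ := ∫⁻ θ, M.p θ * M.h θ ∂M.base

/-- The states at which the approximate posterior density is positive. -/
def posteriorSupport (M : ABCModel Θ Y) : Set Θ := {θ | 0 < M.p θ ∧ 0 < M.h θ}

/-- `c(θ, ϑ) = p(θ) q(θ, ϑ)`. -/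
noncomputable def c (M : ABCModel Θ Y) (θ ϑ : Θ) : ℝ≥0 := M.p θ * M.q θ ϑ

/-- The probability of passing the prior-proposal accept-reject step. When `p θ > 0`, the
denominator is positive for almost every proposed `ϑ`. -/
noncomputable def passProb (M : ABCModel Θ Y) (θ ϑ : Θ) : ℝ≥0 := min 1 (M.c ϑ θ / M.c θ ϑ)

theorem measurable_passProb (M : ABCModel Θ Y) :
    Measurable fun d : Θ × Θ => M.passProb d.1 d.2 := by
  have hq : Measurable fun d : Θ × Θ => M.q d.1 d.2 := M.measurable_q
  have hq' : Measurable fun d : Θ × Θ => M.q d.2 d.1 := M.measurable_q.comp measurable_swap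
  have hp := M.measurable_p
  unfold passProb c
  fun_prop

/-- The number of pairs `(x_i, z_i)` simulated until at least one of `x_i`, `z_i` is a hit, where
`s (i - 1) = (x_i, z_i)`. -/
noncomputable def pairsUntilHit (M : ABCModel Θ Y) (s : ℕ → Y × Y) : ℕ∞ :=
  firstTime fun i => M.Hit (s i).1 ∨ M.Hit (s i).2

/-- At the time at which the simulation of pairs stops, the simulation from the proposed parameter
is a hit. -/
def ProposedHits (M : ABCModel Θ Y) (s : ℕ → Y × Y) : Prop :=
  ∃ i : ℕ, M.pairsUntilHit s = (i : ℕ∞) + 1 ∧ M.Hit (s i).2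

open Classical in
/-- One iteration of the 1-hit algorithm from the state `θ` as a function of its random inputs: the
proposal `ϑ`, the uniform variable `u` that decides the first accept-reject step, and the
simulations `s`. It returns the new state and the number `N` of simulated pairs, which is `0` if the
first step rejects and `⊤` if the simulation does not stop (the state is then kept). -/
noncomputable def oneHitUpdate (M : ABCModel Θ Y) (d : Θ × Θ × unitInterval × (ℕ → Y × Y)) : Θ × ℕ∞ :=
  if (M.passProb d.1 d.2.1 : ℝ) < d.2.2.1 then (d.1, 0)
  else (if M.ProposedHits d.2.2.2 then d.2.1 else d.1, M.pairsUntilHit d.2.2.2)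

/-- The joint law of the simulations `(x_i, z_i)`, given `(θ, ϑ)`: they are i.i.d., with
independent `x_i ∼ f_θ` and `z_i ∼ f_ϑ`. -/
noncomputable def simulations (M : ABCModel Θ Y) : Kernel (Θ × Θ) (ℕ → Y × Y) :=
  iidKernel ((M.f.comap Prod.fst measurable_fst) ×ₖ (M.f.comap Prod.snd measurable_snd))

instance (M : ABCModel Θ Y) : IsMarkovKernel M.simulations := by
  unfold simulations; infer_instance

/-- The joint law of `(ϑ, u, s)`, given the current state `θ`: `ϑ ∼ q(θ, ·)`, and given `ϑ` the
variables `u` (uniform on `[0, 1]`) and `s` are independent. -/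
noncomputable def draws (M : ABCModel Θ Y) : Kernel Θ (Θ × unitInterval × (ℕ → Y × Y)) :=
  M.proposal ⊗ₖ ((Kernel.const (Θ × Θ) (volume : Measure unitInterval)) ×ₖ M.simulations)

instance (M : ABCModel Θ Y) : IsMarkovKernel M.draws := by
  unfold draws; infer_instance

/-- The law of the pair (new state, number of simulated pairs) after one iteration of the 1-hit
algorithm, given the current state. -/
noncomputable def oneHitStep (M : ABCModel Θ Y) : Kernel Θ (Θ × ℕ∞) :=
  (Kernel.id ×ₖ M.draws).map M.oneHitUpdate

/-- The 1-hit Markov kernel on the parameter space. -/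
noncomputable def oneHitKernel (M : ABCModel Θ Y) : Kernel Θ Θ := M.oneHitStep.fst

/-- The expected number of proposals made by the rejection sampler, which draws i.i.d. pairs of a
parameter from the (proper) prior and data from its likelihood until the data are a hit. -/
noncomputable def rejectionCost (M : ABCModel Θ Y) [IsProbabilityMeasure M.prior] : ℝ≥0∞ :=
  ∫⁻ ω : ℕ → Θ × Y, (firstTime fun i => M.Hit (ω i).2 : ℕ∞)
    ∂(Measure.infinitePi fun _ : ℕ => M.prior ⊗ₘ M.f)

end Basic

section Chain

variable {Θ Y : Type*} [MeasurableSpace Θ] [MetricSpace Y] [MeasurableSpace Y] [BorelSpace Y]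

theorem measurableSet_hit (M : ABCModel Θ Y) : MeasurableSet {x | M.Hit x} := by
  have : {x | M.Hit x} = Metric.closedBall M.y M.ε := by
    ext x; simp [Hit, dist_comm]
  rw [this]; exact Metric.isClosed_closedBall.measurableSet

theorem measurable_pairsUntilHit (M : ABCModel Θ Y) : Measurable M.pairsUntilHit := by
  refine measurable_firstTime fun i => MeasurableSet.union ?_ ?_
  · exact M.measurableSet_hit.preimage (measurable_fst.comp (measurable_pi_apply i))
  · exact M.measurableSet_hit.preimage (measurable_snd.comp (measurable_pi_apply i))

theorem measurableSet_proposedHits (M : ABCModel Θ Y) : MeasurableSet {s | M.ProposedHits s} := by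
  simp only [ProposedHits, Set.ofPred_exists]
  refine MeasurableSet.iUnion fun i => MeasurableSet.inter ?_ ?_
  · exact M.measurable_pairsUntilHit (measurableSet_singleton ((i : ℕ∞) + 1))
  · exact M.measurableSet_hit.preimage (measurable_snd.comp (measurable_pi_apply i))

theorem measurable_oneHitUpdate (M : ABCModel Θ Y) : Measurable M.oneHitUpdate := by
  have h1 : Measurable fun d : Θ × Θ × unitInterval × (ℕ → Y × Y) => (M.passProb d.1 d.2.1 : ℝ) :=
    (M.measurable_passProb.comp
      (measurable_fst.prodMk (measurable_fst.comp measurable_snd))).coe_nnreal_real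
  have h2 : Measurable fun d : Θ × Θ × unitInterval × (ℕ → Y × Y) => (d.2.2.1 : ℝ) := by fun_prop
  have h3 : Measurable fun d : Θ × Θ × unitInterval × (ℕ → Y × Y) => d.2.2.2 := by fun_prop
  unfold oneHitUpdate
  refine Measurable.ite (measurableSet_lt h1 h2) (by fun_prop) (Measurable.prodMk ?_ ?_)
  · exact Measurable.ite (M.measurableSet_proposedHits.preimage h3) (by fun_prop) (by fun_prop)
  · exact M.measurable_pairsUntilHit.comp h3

instance (M : ABCModel Θ Y) : IsMarkovKernel M.oneHitStep :=
  Kernel.IsMarkovKernel.map _ M.measurable_oneHitUpdate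

/-- The law of `((θ₀, 0), (θ₁, N₁), (θ₂, N₂), …)` when `θ₀ ∼ ν` and the 1-hit algorithm is iterated:
`(θ_i, N_i)` are the output and the number of simulated pairs of the `i`-th iteration. -/
noncomputable def oneHitChain (M : ABCModel Θ Y) (ν : Measure Θ) : Measure (ℕ → Θ × ℕ∞) :=
  Kernel.trajMeasure (X := fun _ : ℕ => Θ × ℕ∞) (ν.map fun θ => (θ, 0)) fun n =>
    M.oneHitStep.comap (fun past => (past ⟨n, Finset.mem_Iic.2 le_rfl⟩).1)
      (measurable_fst.comp (measurable_pi_apply _))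

end Chain

end ABCModel

/-! Write π ∝ p·h for the approximate posterior and S for the set where p·h > 0. The constant is the
stationary mean n = ∫ E[N | θ] π(dθ) (`meanCost`). A race between θ and a proposal ϑ is over at the
latest when θ hits, so E[N | θ] ≤ 1/h(θ). The factor h(θ) in π cancels this bound, and n ≤ H⁻¹ ∫ p =
H⁻¹. The rejection sampler waits a geometric time with success probability H, hence the mean H⁻¹.

Convergence from almost every start: P₃ is reversible for π (`oneHitKernel_isReversible`). Sublevel
sets of a bounded harmonic function are absorbing up to π-null sets, and by reversibility so are
their complements. Irreducibility lets only one of the two have positive π-measure, so bounded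
harmonic functions are π-a.e. constant (`IsReversible.ae_eq_const_of_harmonic`). This makes the
shift ergodic on the stationary path space of the pairs (θ_i, N_i) (`Invariant.ergodic_shift`), and
Birkhoff's theorem, proved here from a maximal inequality, gives the limit.

Convergence from every start in S (`averageProb_eq_one`): let U(θ) be the probability of convergence
from θ. Then U = 1 π-a.e., and P₃U ≤ U on S because one finite term does not affect a limit of
averages. An accepted move has a density and lands in S, so it avoids the π-null set where U ≠ 1. If
moves have probability K > 0, then K ≤ K·U(θ), so U(θ) = 1. If K = 0, the state θ is absorbing, and
irreducibility forces π to be the point mass at θ. -/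

section Birkhoff

/-! ### Maximal ergodic inequality and the pointwise ergodic theorem. -/

variable {Ω : Type*}

/-- The maximum of the first `n + 1` Birkhoff sums of `f`, the empty one included. -/
noncomputable def maxBirkhoffSum (T : Ω → Ω) (f : Ω → ℝ) : ℕ → Ω → ℝ
  | 0 => fun _ => 0
  | n + 1 => fun x => max 0 (f x + maxBirkhoffSum T f n (T x))

theorem maxBirkhoffSum_nonneg (T : Ω → Ω) (f : Ω → ℝ) (n : ℕ) (x : Ω) :
    0 ≤ maxBirkhoffSum T f n x := by
  cases n with
  | zero => exact le_rfl
  | succ n => exact le_max_left _ _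

theorem monotone_maxBirkhoffSum (T : Ω → Ω) (f : Ω → ℝ) (x : Ω) :
    Monotone fun n => maxBirkhoffSum T f n x := by
  refine monotone_nat_of_le_succ fun n => ?_
  induction n generalizing x with
  | zero => exact maxBirkhoffSum_nonneg T f 1 x
  | succ n ih => exact max_le_max le_rfl (add_le_add_right (ih (T x)) _)

theorem birkhoffSum_le_maxBirkhoffSum (T : Ω → Ω) (f : Ω → ℝ) (n : ℕ) (x : Ω) :
    birkhoffSum T f n x ≤ maxBirkhoffSum T f n x := by
  induction n generalizing x with
  | zero => simp [maxBirkhoffSum]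
  | succ n ih =>
    rw [birkhoffSum_succ']
    exact (add_le_add_right (ih (T x)) _).trans (le_max_right _ _)

variable [MeasurableSpace Ω]

theorem integrable_maxBirkhoffSum {μ : Measure Ω} {T : Ω → Ω} (hT : MeasurePreserving T μ μ)
    {f : Ω → ℝ} (hf : Integrable f μ) (n : ℕ) : Integrable (maxBirkhoffSum T f n) μ := by
  induction n with
  | zero => exact integrable_zero _ _ _
  | succ n ih => exact (integrable_zero _ _ _).sup (hf.add (hT.integrable_comp_of_integrable ih))

/-- With M_n = `maxBirkhoffSum T f n`, the recursion gives M_{n+1} − M_n∘T = max(−M_n∘T, f). Its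
integral is nonnegative, since T preserves μ and M_n ≤ M_{n+1}. Unbounded sums make M_n∘T grow to
infinity, so the maximum is eventually f, and |f| dominates. -/
theorem integral_nonneg_of_birkhoffSum_unbounded {μ : Measure Ω} {T : Ω → Ω}
    (hT : MeasurePreserving T μ μ) {f : Ω → ℝ} (hf : Integrable f μ)
    (h : ∀ᵐ x ∂μ, ∀ K : ℝ, ∃ n, K < birkhoffSum T f n x) : 0 ≤ ∫ x, f x ∂μ := by
  have hM := integrable_maxBirkhoffSum hT hf
  have hMT : ∀ n, Integrable (fun x => maxBirkhoffSum T f n (T x)) μ :=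
    fun n => hT.integrable_comp_of_integrable (hM n)
  have key : ∀ n, 0 ≤ ∫ x, max (-maxBirkhoffSum T f n (T x)) (f x) ∂μ := by
    intro n
    have h1 : ∀ x, max (-maxBirkhoffSum T f n (T x)) (f x) =
        maxBirkhoffSum T f (n + 1) x - maxBirkhoffSum T f n (T x) := by
      intro x
      simp only [maxBirkhoffSum]
      rw [max_sub_sub_right .. |>.symm]
      congr 1 <;> ring
    have h2 : ∫ x, maxBirkhoffSum T f n (T x) ∂μ = ∫ x, maxBirkhoffSum T f n x ∂μ := by
      have := integral_map (μ := μ) hT.measurable.aemeasurable (f := maxBirkhoffSum T f n)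
        (by rw [hT.map_eq]; exact (hM n).aestronglyMeasurable)
      rw [hT.map_eq] at this
      exact this.symm
    simp_rw [h1]
    rw [integral_sub (hM _) (hMT n), h2, sub_nonneg]
    exact integral_mono (hM _) (hM _) fun x => monotone_maxBirkhoffSum T f x n.le_succ
  refine ge_of_tendsto' (tendsto_integral_of_dominated_convergence (fun x => |f x|)
    (fun n => (Integrable.sup (hMT n).neg hf).aestronglyMeasurable) hf.abs (fun n => ?_) ?_) key
  · refine ae_of_all _ fun x => ?_
    have := maxBirkhoffSum_nonneg T f n (T x)
    rw [Real.norm_eq_abs]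
    refine abs_le.2 ⟨(neg_abs_le _).trans (le_max_right _ _), max_le ?_ (le_abs_self _)⟩
    change -maxBirkhoffSum T f n (T x) ≤ _
    linarith [abs_nonneg (f x)]
  · have hT' : ∀ᵐ x ∂μ, ∀ K : ℝ, ∃ n, K < birkhoffSum T f n (T x) :=
      hT.quasiMeasurePreserving.ae h
    filter_upwards [hT'] with x hx
    obtain ⟨n, hn⟩ := hx (-f x)
    refine tendsto_const_nhds.congr' ?_
    filter_upwards [eventually_ge_atTop n] with m hm
    refine (max_eq_right ?_).symm
    have : _ ≤ maxBirkhoffSum T f m (T x) := (birkhoffSum_le_maxBirkhoffSum T f n (T x)).trans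
      (monotone_maxBirkhoffSum T f (T x) hm)
    change -maxBirkhoffSum T f m (T x) ≤ _
    linarith

theorem measurable_birkhoffSum {T : Ω → Ω} (hT : Measurable T) {f : Ω → ℝ} (hf : Measurable f)
    (n : ℕ) : Measurable (birkhoffSum T f n) :=
  Finset.measurable_fun_sum _ fun i _ => hf.comp (hT.iterate i)

/-- The set of points with unbounded sums is strictly invariant, hence null or conull; conull would
make the integral nonnegative. -/
theorem Ergodic.ae_birkhoffSum_bddAbove {μ : Measure Ω} {T : Ω → Ω} (hT : Ergodic T μ)
    {f : Ω → ℝ} (hfm : Measurable f) (hf : Integrable f μ) (h0 : ∫ x, f x ∂μ < 0) :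
    ∀ᵐ x ∂μ, ∃ K : ℝ, ∀ n, birkhoffSum T f n x ≤ K := by
  set B : Set Ω := {x | ∀ K : ℕ, ∃ n, (K : ℝ) < birkhoffSum T f n x} with hB
  have hBm : MeasurableSet B := by
    simp only [hB, Set.ofPred_forall, Set.ofPred_exists]
    exact MeasurableSet.iInter fun K => MeasurableSet.iUnion fun n =>
      measurableSet_lt measurable_const (measurable_birkhoffSum hT.measurable hfm n)
  have hBK : ∀ x ∈ B, ∀ K : ℝ, ∃ n, K < birkhoffSum T f n x := by
    intro x hx K
    obtain ⟨k, hk⟩ := exists_nat_ge K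
    obtain ⟨n, hn⟩ := hx k
    exact ⟨n, hk.trans_lt hn⟩
  have hBi : T ⁻¹' B = B := by
    ext x
    constructor
    · intro hx K
      obtain ⟨n, hn⟩ := hBK _ hx (K - f x)
      exact ⟨n + 1, by rw [birkhoffSum_succ']; linarith⟩
    · intro hx K
      -- The maximum with 0 rules out the empty sum, so that a first term can be split off.
      obtain ⟨n, hn⟩ := hBK _ hx (max 0 (K + f x))
      cases n with
      | zero => simp at hn
      | succ n =>
        rw [birkhoffSum_succ'] at hn
        exact ⟨n, by linarith [le_max_right 0 (K + f x)]⟩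
  rcases hT.toPreErgodic.ae_mem_or_ae_notMem hBm hBi with h | h
  · exact absurd (integral_nonneg_of_birkhoffSum_unbounded hT.toMeasurePreserving hf
      (h.mono hBK)) (not_le.2 h0)
  · filter_upwards [h] with x hx
    simp only [hB, Set.mem_ofPred_eq, not_forall, not_exists, not_lt] at hx
    obtain ⟨K, hK⟩ := hx
    exact ⟨K, hK⟩

/-- For d strictly between the mean and c, the sums of f − d are bounded by some K, so S_n ≤ nd + K,
which is below nc once n(c − d) > K. Applied to f and −f, this gives both halves of the ergodic
theorem. -/
theorem Ergodic.ae_eventually_birkhoffSum_div_lt {μ : Measure Ω} [IsProbabilityMeasure μ]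
    {T : Ω → Ω} (hT : Ergodic T μ) {f : Ω → ℝ} (hfm : Measurable f) (hf : Integrable f μ) {c : ℝ}
    (hc : ∫ x, f x ∂μ < c) : ∀ᵐ x ∂μ, ∀ᶠ n : ℕ in atTop, birkhoffSum T f n x / n < c := by
  obtain ⟨d, hd, hdc⟩ := exists_between hc
  have h0 : ∫ x, (f x - d) ∂μ < 0 := by
    rw [integral_sub hf (integrable_const _)]
    simpa using hd
  filter_upwards [hT.ae_birkhoffSum_bddAbove (hfm.sub_const d) (hf.sub (integrable_const d)) h0]
    with x ⟨K, hK⟩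
  obtain ⟨k, hk⟩ := exists_nat_gt (K / (c - d))
  filter_upwards [eventually_ge_atTop (k + 1)] with n hn
  have hn0 : (0 : ℝ) < n := by exact_mod_cast (Nat.succ_pos k).trans_le hn
  have h1 := hK n
  have h2 : birkhoffSum T (fun x => f x - d) n x = birkhoffSum T f n x - n * d := by
    simp [birkhoffSum, Finset.sum_sub_distrib]
  rw [h2] at h1
  rw [div_lt_iff₀ hn0]
  rw [div_lt_iff₀ (sub_pos.2 hdc)] at hk
  have h3 : (k : ℝ) * (c - d) ≤ n * (c - d) :=
    mul_le_mul_of_nonneg_right (by exact_mod_cast (Nat.le_succ k).trans hn) (sub_pos.2 hdc).le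
  linarith

/-- The pointwise ergodic theorem for an ergodic transformation. -/
theorem Ergodic.ae_tendsto_birkhoffSum_div {μ : Measure Ω} [IsProbabilityMeasure μ]
    {T : Ω → Ω} (hT : Ergodic T μ) {f : Ω → ℝ} (hfm : Measurable f) (hf : Integrable f μ) :
    ∀ᵐ x ∂μ, Tendsto (fun n : ℕ => birkhoffSum T f n x / n) atTop (𝓝 (∫ x, f x ∂μ)) := by
  set I := ∫ x, f x ∂μ with hI
  have h1 : ∀ᵐ x ∂μ, ∀ k : ℕ, ∀ᶠ n : ℕ in atTop,
      birkhoffSum T f n x / n < I + 1 / ((k : ℝ) + 1) :=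
    ae_all_iff.2 fun k => hT.ae_eventually_birkhoffSum_div_lt hfm hf
      (lt_add_of_pos_right _ Nat.one_div_pos_of_nat)
  have h2 : ∀ᵐ x ∂μ, ∀ k : ℕ, ∀ᶠ n : ℕ in atTop,
      birkhoffSum T (fun x => -f x) n x / n < -I + 1 / ((k : ℝ) + 1) :=
    ae_all_iff.2 fun k => hT.ae_eventually_birkhoffSum_div_lt hfm.neg hf.neg
      (by rw [integral_neg']; exact lt_add_of_pos_right _ Nat.one_div_pos_of_nat)
  filter_upwards [h1, h2] with x hx1 hx2
  rw [Metric.tendsto_atTop']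
  intro ε hε
  obtain ⟨k, hk⟩ := exists_nat_one_div_lt hε
  obtain ⟨n0, hn0⟩ := eventually_atTop.1 ((hx1 k).and (hx2 k))
  refine ⟨n0, fun n hn => ?_⟩
  obtain ⟨ha, hb⟩ := hn0 n hn.le
  have h3 : birkhoffSum T (fun x => -f x) n x / n = -(birkhoffSum T f n x / n) := by
    simp [birkhoffSum, neg_div]
  rw [h3] at hb
  rw [Real.dist_eq, abs_lt]
  constructor <;> linarith

end Birkhoff

/-! ### Path space of a homogeneous Markov chain: Markov property and ergodicity of the shift. -/

namespace ProbabilityTheory.Kernel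

section Path

variable {X : Type*} [MeasurableSpace X]

/-- The transition kernels of a homogeneous Markov chain, as functions of the whole past. -/
noncomputable def homogeneous (κ : Kernel X X) (n : ℕ) :
    Kernel ((i : Finset.Iic n) → (fun _ : ℕ => X) i) X :=
  κ.comap (fun past => past ⟨n, Finset.mem_Iic.2 le_rfl⟩) (measurable_pi_apply _)

variable (κ : Kernel X X)

instance [IsMarkovKernel κ] (n : ℕ) : IsMarkovKernel (homogeneous κ n) := by
  unfold homogeneous; infer_instance

/-- The expectation of `ψ (ω n)` on the event that `ω i ∈ A i` for all `i < n`, computed by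
integrating over the successive states of the chain, as a function of the starting point. -/
noncomputable def cylinderIntegral (ψ : X → ℝ≥0∞) : ℕ → (ℕ → Set X) → X → ℝ≥0∞
  | 0, _ => ψ
  | n + 1, A => (A 0).indicator fun x => ∫⁻ y, cylinderIntegral ψ n (fun i => A (i + 1)) y ∂κ x

/-- The definition peels off the first state, as the Markov property at time 1 requires; trajectory
measures are built by adding a last state. This identity links the two. -/
theorem cylinderIntegral_succ_last (ψ : X → ℝ≥0∞) (n : ℕ) (A : ℕ → Set X) :
    cylinderIntegral κ ψ (n + 1) A =
      cylinderIntegral κ ((A n).indicator fun x => ∫⁻ y, ψ y ∂κ x) n A := by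
  induction n generalizing A with
  | zero => rfl
  | succ n ih =>
    rw [cylinderIntegral, ih]
    rfl

theorem measurable_cylinderIntegral {A : ℕ → Set X} (hA : ∀ i, MeasurableSet (A i))
    {ψ : X → ℝ≥0∞} (hψ : Measurable ψ) (n : ℕ) : Measurable (cylinderIntegral κ ψ n A) := by
  induction n generalizing A with
  | zero => exact hψ
  | succ n ih => exact (Measurable.lintegral_kernel (ih fun i => hA (i + 1))).indicator (hA 0)

variable [IsMarkovKernel κ]

/-- The law of a homogeneous Markov chain as a function of its starting point. -/
noncomputable def pathKernel : Kernel X (ℕ → X) :=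
  (traj (X := fun _ : ℕ => X) (homogeneous κ) 0).comap
    (MeasurableEquiv.piUnique (fun _ : Finset.Iic 0 => X)).symm (MeasurableEquiv.measurable _)

instance : IsMarkovKernel (pathKernel κ) := by
  unfold pathKernel; infer_instance

theorem trajMeasure_homogeneous (μ : Measure X) :
    trajMeasure (X := fun _ : ℕ => X) μ (homogeneous κ) = pathKernel κ ∘ₘ μ := by
  ext s hs
  rw [trajMeasure, Measure.bind_apply hs (Kernel.aemeasurable _),
    Measure.bind_apply hs (Kernel.aemeasurable _),
    MeasureTheory.lintegral_map (Kernel.measurable_coe _ hs) (MeasurableEquiv.measurable _)]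
  rfl

theorem pathKernel_map_eval_zero (x : X) :
    (pathKernel κ x).map (fun ω => ω 0) = Measure.dirac x := by
  have h1 : (fun ω : ℕ → X => ω 0) = (fun p : (i : Finset.Iic 0) → X => p ⟨0, by simp⟩) ∘
      (Preorder.frestrictLe (π := fun _ : ℕ => X) 0) := rfl
  have h2 : Measurable fun p : (i : Finset.Iic 0) → X => p ⟨0, by simp⟩ := measurable_pi_apply _
  rw [h1, ← Measure.map_map h2 (Preorder.measurable_frestrictLe (X := fun _ : ℕ => X) _),
    pathKernel, comap_apply, ← map_apply _ (Preorder.measurable_frestrictLe _),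
    traj_map_frestrictLe_of_le le_rfl, deterministic_apply]
  exact Measure.map_dirac' h2 _

theorem setLIntegral_trajMeasure_cylinder {μ : Measure X} [IsProbabilityMeasure μ] {A : ℕ → Set X}
    (hA : ∀ i, MeasurableSet (A i)) {ψ : X → ℝ≥0∞} (hψ : Measurable ψ) (n : ℕ) :
    ∫⁻ ω in {ω | ∀ i < n, ω i ∈ A i}, ψ (ω n)
        ∂(trajMeasure (X := fun _ : ℕ => X) μ (homogeneous κ)) =
      ∫⁻ x, cylinderIntegral κ ψ n A x ∂μ := by
  induction n generalizing ψ with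
  | zero =>
    simp only [Nat.not_lt_zero, false_imp_iff, implies_true, Set.ofPred_true, Measure.restrict_univ,
      cylinderIntegral]
    rw [trajMeasure_homogeneous, Measure.lintegral_bind (Kernel.aemeasurable _)
      (Measurable.aemeasurable (by fun_prop))]
    congr 1 with x
    rw [← MeasureTheory.lintegral_map (f := ψ) (g := fun ω : ℕ → X => ω 0) hψ (measurable_pi_apply 0),
      pathKernel_map_eval_zero, lintegral_dirac' _ hψ]
  | succ n ih =>
    set P := trajMeasure (X := fun _ : ℕ => X) μ (homogeneous κ) with hP
    have hκψ : Measurable fun x => ∫⁻ y, ψ y ∂κ x := hψ.lintegral_kernel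
    rw [cylinderIntegral_succ_last, ← ih (hκψ.indicator (hA n))]
    set C : Set ((i : Finset.Iic n) → X) := {p | ∀ i : Finset.Iic n, p i ∈ A i} with hC
    have hCm : MeasurableSet C := by
      simp only [hC, Set.ofPred_forall]
      exact MeasurableSet.iInter fun i => (measurable_pi_apply i) (hA i)
    have hfr := Preorder.measurable_frestrictLe (X := fun _ : ℕ => X) n
    have hG : Measurable fun q : ((i : Finset.Iic n) → X) × X => C.indicator (fun _ => ψ q.2) q.1 := by
      have : (fun q : ((i : Finset.Iic n) → X) × X => C.indicator (fun _ => ψ q.2) q.1) =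
          (Prod.fst ⁻¹' C).indicator fun q => ψ q.2 := by
        ext q
        by_cases h : q.1 ∈ C <;> simp [h]
      rw [this]
      exact (hψ.comp measurable_snd).indicator (measurable_fst hCm)
    have key := map_frestrictLe_trajMeasure_compProd_eq_map_trajMeasure
      (X := fun _ : ℕ => X) (μ₀ := μ) (κ := homogeneous κ) (a := n)
    -- The joint law of the past up to n and the state at n + 1 is tested against 1_C(past)·ψ(next).
    have h1 := congrArg (fun m => ∫⁻ q, C.indicator (fun _ => ψ q.2) q.1 ∂m) key
    beta_reduce at h1
    rw [Measure.lintegral_compProd hG, MeasureTheory.lintegral_map hG (by fun_prop),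
      MeasureTheory.lintegral_map (Measurable.lintegral_kernel_prod_right' hG) hfr] at h1
    have hn : ∀ k, MeasurableSet {ω : ℕ → X | ∀ i < k, ω i ∈ A i} := fun k => by
      simp only [Set.ofPred_forall]
      exact MeasurableSet.iInter fun i => MeasurableSet.iInter fun _ =>
        (measurable_pi_apply i) (hA i)
    rw [← lintegral_indicator (hn _), ← lintegral_indicator (hn _)]
    have hmem : ∀ ω : ℕ → X, Preorder.frestrictLe (π := fun _ : ℕ => X) n ω ∈ C ↔
        ∀ i < n + 1, ω i ∈ A i := fun ω =>
      ⟨fun h i hi => h ⟨i, Finset.mem_Iic.2 (Nat.lt_succ_iff.1 hi)⟩,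
        fun h i => h i (Nat.lt_succ_iff.2 (Finset.mem_Iic.1 i.2))⟩
    have hmem' : ∀ ω : ℕ → X, (∀ i < n + 1, ω i ∈ A i) ↔ (∀ i < n, ω i ∈ A i) ∧ ω n ∈ A n :=
      fun ω => Nat.forall_lt_succ_right
    refine Eq.trans ?_ (h1.symm.trans ?_)
    · refine lintegral_congr fun ω => ?_
      by_cases h : ∀ i < n + 1, ω i ∈ A i
      · rw [Set.indicator_of_mem (show ω ∈ {ω : ℕ → X | ∀ i < n + 1, ω i ∈ A i} from h),
          Set.indicator_of_mem ((hmem ω).2 h)]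
      · rw [Set.indicator_of_notMem (show ω ∉ {ω : ℕ → X | ∀ i < n + 1, ω i ∈ A i} from h),
          Set.indicator_of_notMem fun hh => h ((hmem ω).1 hh)]
    · refine lintegral_congr fun ω => ?_
      by_cases h : ∀ i < n + 1, ω i ∈ A i
      · have hc := (hmem ω).2 h
        rw [Set.indicator_of_mem (show ω ∈ {ω : ℕ → X | ∀ i < n, ω i ∈ A i} from
          ((hmem' ω).1 h).1), Set.indicator_of_mem ((hmem' ω).1 h).2]
        simp only [Set.indicator_of_mem hc]
        rfl
      · have hc : Preorder.frestrictLe (π := fun _ : ℕ => X) n ω ∉ C := fun hh => h ((hmem ω).1 hh)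
        simp only [Set.indicator_of_notMem hc, lintegral_zero]
        by_cases h2 : ∀ i < n, ω i ∈ A i
        · rw [Set.indicator_of_mem (show ω ∈ {ω : ℕ → X | ∀ i < n, ω i ∈ A i} from h2),
            Set.indicator_of_notMem fun h3 => h ((hmem' ω).2 ⟨h2, h3⟩)]
        · rw [Set.indicator_of_notMem (show ω ∉ {ω : ℕ → X | ∀ i < n, ω i ∈ A i} from h2)]

theorem pathKernel_cylinder {A : ℕ → Set X} (hA : ∀ i, MeasurableSet (A i)) (n : ℕ) (x : X)
    (hm : Measurable (cylinderIntegral κ 1 n A)) :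
    pathKernel κ x {ω | ∀ i < n, ω i ∈ A i} = cylinderIntegral κ 1 n A x := by
  have h := setLIntegral_trajMeasure_cylinder κ (μ := Measure.dirac x) hA
    (measurable_one (α := ℝ≥0∞)) n
  rw [trajMeasure_homogeneous, Measure.dirac_bind (Kernel.measurable _),
    lintegral_dirac' _ hm] at h
  simpa using h

/-- Measures on sequence space agree if they agree on the cylinders over initial segments. -/
theorem _root_.MeasureTheory.Measure.ext_of_initial_cylinders {P Q : Measure (ℕ → X)}
    [IsFiniteMeasure P]
    (h : ∀ A : ℕ → Set X, (∀ i, MeasurableSet (A i)) → ∀ n : ℕ,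
      P {ω | ∀ i < n, ω i ∈ A i} = Q {ω | ∀ i < n, ω i ∈ A i}) : P = Q := by
  refine ext_of_generate_finite _ (generateFrom_squareCylinders (α := fun _ : ℕ => X)).symm
    (isPiSystem_squareCylinders (fun _ => MeasurableSpace.isPiSystem_measurableSet) (by simp))
    ?_ (by simpa using h (fun _ => Set.univ) (fun _ => .univ) 0)
  rintro s ⟨J, t, ht, rfl⟩
  classical
  -- A finite-dimensional cylinder becomes an initial one by leaving the missing coordinates free.
  have hs : (J : Set ℕ).pi t =
      {ω | ∀ i < J.sup id + 1, ω i ∈ if i ∈ J then t i else Set.univ} := by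
    ext ω
    simp only [Set.mem_pi, Finset.mem_coe, Set.mem_ofPred_eq]
    refine ⟨fun H i _ => ?_, fun H i hi => ?_⟩
    · split_ifs with hi
      · exact H i hi
      · trivial
    · have := H i (Nat.lt_succ_of_le (Finset.le_sup (f := id) hi))
      rwa [if_pos hi] at this
  rw [hs]
  refine h _ (fun i => ?_) _
  split_ifs
  · exact ht i (Set.mem_univ i)
  · exact .univ

/-- The shift of sequences. -/
def _root_.seqShift (ω : ℕ → X) : ℕ → X := fun i => ω (i + 1)

theorem _root_.measurable_seqShift : Measurable (seqShift (X := X)) :=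
  measurable_pi_lambda _ fun i => measurable_pi_apply (i + 1)

/-- The Markov property at time 1. On cylinders it is the recursion defining `cylinderIntegral`,
with a free coordinate put in front. -/
theorem pathKernel_map_shift (x : X) :
    (pathKernel κ x).map seqShift = pathKernel κ ∘ₘ κ x := by
  have : IsProbabilityMeasure ((pathKernel κ x).map seqShift) :=
    Measure.isProbabilityMeasure_map measurable_seqShift.aemeasurable
  refine Measure.ext_of_initial_cylinders fun A hA n => ?_
  have hm : MeasurableSet {ω : ℕ → X | ∀ i < n, ω i ∈ A i} := by
    simp only [Set.ofPred_forall]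
    exact MeasurableSet.iInter fun i => MeasurableSet.iInter fun _ =>
        (measurable_pi_apply i) (hA i)
  rw [Measure.map_apply measurable_seqShift hm, Measure.bind_apply hm (Kernel.aemeasurable _)]
  simp_rw [fun y => pathKernel_cylinder κ hA n y (measurable_cylinderIntegral κ hA measurable_one n)]
  set A' : ℕ → Set X := fun i => Nat.casesOn i Set.univ A with hA'
  have hA'm : ∀ i, MeasurableSet (A' i) := by
    rintro (_ | i)
    · exact .univ
    · exact hA i
  have hs : seqShift ⁻¹' {ω : ℕ → X | ∀ i < n, ω i ∈ A i} = {ω | ∀ i < n + 1, ω i ∈ A' i} := by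
    ext ω
    simp only [Set.mem_preimage, Set.mem_ofPred_eq, seqShift]
    refine ⟨fun H i hi => ?_, fun H i hi => H (i + 1) (Nat.succ_lt_succ hi)⟩
    cases i with
    | zero => trivial
    | succ i => exact H i (Nat.lt_of_succ_lt_succ hi)
  rw [hs, pathKernel_cylinder κ hA'm _ x (measurable_cylinderIntegral κ hA'm measurable_one _),
    cylinderIntegral]
  exact Set.indicator_of_mem (Set.mem_univ x) _

theorem pathKernel_shift_apply (x : X) {B : Set (ℕ → X)} (hB : MeasurableSet B) :
    pathKernel κ x (seqShift ⁻¹' B) = ∫⁻ y, pathKernel κ y B ∂κ x := by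
  rw [← Measure.map_apply measurable_seqShift hB, pathKernel_map_shift,
    Measure.bind_apply hB (Kernel.aemeasurable _)]

theorem pathKernel_inter_shift (x : X) {A : Set X} (hA : MeasurableSet A) {B : Set (ℕ → X)}
    (hB : MeasurableSet B) :
    pathKernel κ x ({ω | ω 0 ∈ A} ∩ seqShift ⁻¹' B) =
      A.indicator (fun x => ∫⁻ y, pathKernel κ y B ∂κ x) x := by
  have h0 := congrArg (fun m => m Aᶜ) (pathKernel_map_eval_zero κ x)
  have h1 := congrArg (fun m => m A) (pathKernel_map_eval_zero κ x)
  beta_reduce at h0 h1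
  rw [Measure.map_apply (measurable_pi_apply 0) hA.compl, Measure.dirac_apply' _ hA.compl] at h0
  rw [Measure.map_apply (measurable_pi_apply 0) hA, Measure.dirac_apply' _ hA] at h1
  by_cases hx : x ∈ A
  · rw [Set.indicator_of_mem hx, ← pathKernel_shift_apply κ x hB, Set.inter_comm]
    rw [Set.indicator_of_notMem (by simpa using hx)] at h0
    exact measure_inter_conull h0
  · rw [Set.indicator_of_notMem hx]
    rw [Set.indicator_of_notMem hx] at h1
    exact measure_mono_null Set.inter_subset_left h1

variable {κ}

theorem Invariant.measurePreserving_shift {μ : Measure X} (hμ : κ.Invariant μ) :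
    MeasurePreserving seqShift (pathKernel κ ∘ₘ μ) (pathKernel κ ∘ₘ μ) := by
  refine ⟨measurable_seqShift, ?_⟩
  rw [Measure.map_comp _ _ measurable_seqShift]
  have : (pathKernel κ).map seqShift = pathKernel κ ∘ₖ κ := by
    ext1 x
    rw [map_apply _ measurable_seqShift, pathKernel_map_shift, comp_apply]
  rw [this, ← Measure.comp_assoc, hμ.def]

/-- A stationary Markov chain whose bounded harmonic functions are almost everywhere constant is
ergodic. -/
theorem Invariant.ergodic_shift {μ : Measure X} [IsProbabilityMeasure μ] (hμ : κ.Invariant μ)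
    (hc : ∀ u : X → ℝ≥0∞, Measurable u → (∀ x, u x ≤ 1) → (∀ x, u x = ∫⁻ y, u y ∂κ x) →
      ∃ c, ∀ᵐ x ∂μ, u x = c) :
    Ergodic seqShift (pathKernel κ ∘ₘ μ) := by
  refine { hμ.measurePreserving_shift with aeconst_set := fun B hB hBi => ?_ }
  set P := pathKernel κ ∘ₘ μ with hP
  have hu : Measurable fun x => pathKernel κ x B := Kernel.measurable_coe _ hB
  -- For a shift-invariant B, the function x ↦ P_x(B) is harmonic by the Markov property, hence a.e.
  -- a constant c.
  obtain ⟨c, hc⟩ := hc _ hu (fun x => prob_le_one) fun x => by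
    rw [← pathKernel_shift_apply κ x hB, hBi]
  have hcyl : ∀ A : ℕ → Set X, (∀ i, MeasurableSet (A i)) → ∀ n : ℕ,
      MeasurableSet {ω : ℕ → X | ∀ i < n, ω i ∈ A i} := fun A hA n => by
    simp only [Set.ofPred_forall]
    exact MeasurableSet.iInter fun i => MeasurableSet.iInter fun _ =>
        (measurable_pi_apply i) (hA i)
  -- B is independent of every cylinder, hence of itself, which yields c = c² below.
  have key : ∀ n : ℕ, ∀ A : ℕ → Set X, (∀ i, MeasurableSet (A i)) → ∀ᵐ x ∂μ,
      pathKernel κ x ({ω | ∀ i < n, ω i ∈ A i} ∩ B) =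
        c * pathKernel κ x {ω | ∀ i < n, ω i ∈ A i} := by
    intro n
    induction n with
    | zero =>
      intro A _
      filter_upwards [hc] with x hx
      simpa using hx
    | succ n ih =>
      intro A hA
      have hA' : ∀ i, MeasurableSet (A (i + 1)) := fun i => hA (i + 1)
      have h1 := ih (fun i => A (i + 1)) hA'
      -- By invariance, a property of μ-almost all states holds for κ x-almost all successors of
      -- μ-almost every x.
      rw [← hμ.def] at h1
      filter_upwards [Measure.ae_ae_of_ae_comp h1] with x hx
      have hs : {ω : ℕ → X | ∀ i < n + 1, ω i ∈ A i} =
          {ω | ω 0 ∈ A 0} ∩ seqShift ⁻¹' {ω | ∀ i < n, ω i ∈ A (i + 1)} := by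
        ext ω
        simp only [Set.mem_inter_iff, Set.mem_preimage, Set.mem_ofPred_eq, seqShift]
        refine ⟨fun H => ⟨H 0 n.succ_pos, fun i hi => H (i + 1) (Nat.succ_lt_succ hi)⟩,
          fun H i hi => ?_⟩
        cases i with
        | zero => exact H.1
        | succ i => exact H.2 i (Nat.lt_of_succ_lt_succ hi)
      have hs' : {ω : ℕ → X | ∀ i < n + 1, ω i ∈ A i} ∩ B =
          {ω | ω 0 ∈ A 0} ∩ seqShift ⁻¹' ({ω | ∀ i < n, ω i ∈ A (i + 1)} ∩ B) := by
        rw [hs, Set.inter_assoc, Set.preimage_inter, hBi]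
      have hm := hcyl _ hA' n
      rw [hs', hs, pathKernel_inter_shift κ x (hA 0) (hm.inter hB),
        pathKernel_inter_shift κ x (hA 0) hm]
      by_cases hxA : x ∈ A 0
      · simp only [Set.indicator_of_mem hxA]
        rw [lintegral_congr_ae hx, lintegral_const_mul _ (Kernel.measurable_coe _ hm)]
      · simp [Set.indicator_of_notMem hxA]
  have hrestr : P.restrict B = c • P := by
    refine Measure.ext_of_initial_cylinders fun A hA n => ?_
    have hm := hcyl A hA n
    rw [Measure.restrict_apply hm, Measure.smul_apply, smul_eq_mul, hP,
      Measure.bind_apply (hm.inter hB) (Kernel.aemeasurable _),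
      Measure.bind_apply hm (Kernel.aemeasurable _), lintegral_congr_ae (key n A hA),
      lintegral_const_mul _ (Kernel.measurable_coe _ hm)]
  have hPB : P B = c := by
    have := congrArg (fun m => m Set.univ) hrestr
    simpa using this
  have hPBB : c = c * c := by
    have := congrArg (fun m => m B) hrestr
    simpa [hPB] using this
  rw [eventuallyConst_set']
  have hc1 : c ≤ 1 := hPB ▸ prob_le_one
  have hct : c ≠ ∞ := ne_top_of_le_ne_top ENNReal.one_ne_top hc1
  by_cases h0 : c = 0
  · left
    rw [ae_eq_empty, hPB, h0]
  · right
    have : c = 1 := by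
      have h2 : c * 1 = c * c := by rw [mul_one]; exact hPBB
      exact ((ENNReal.mul_right_inj h0 hct).1 h2).symm
    rw [ae_eq_univ, prob_compl_eq_zero_iff hB, hPB, this]

end Path

end ProbabilityTheory.Kernel

/-! ### Absorbing sets and harmonic functions of reversible chains. -/

namespace ProbabilityTheory.Kernel

section Absorbing

variable {α : Type*} [MeasurableSpace α] {κ : Kernel α α} {π : Measure α}

theorem pow_succ_apply_eq_lintegral' (κ : Kernel α α) (n : ℕ) (a : α) {s : Set α}
    (hs : MeasurableSet s) : (κ ^ (n + 1)) a s = ∫⁻ b, (κ ^ n) b s ∂κ a := by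
  rw [add_comm, pow_add_apply_eq_lintegral κ 1 n a hs, pow_one]

/-- Under an invariant measure, almost all states of an absorbing set never reach its
complement. -/
theorem Invariant.ae_pow_compl_eq_zero (hπ : κ.Invariant π) {A : Set α} (hA : MeasurableSet A)
    (habs : ∀ᵐ a ∂π, a ∈ A → κ a Aᶜ = 0) (n : ℕ) : ∀ᵐ a ∂π, a ∈ A → (κ ^ n) a Aᶜ = 0 := by
  induction n with
  | zero =>
    refine ae_of_all _ fun a ha => ?_
    rw [pow_zero]
    change Kernel.id a Aᶜ = 0
    rw [id_apply, Measure.dirac_apply' _ hA.compl]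
    simpa using ha
  | succ n ih =>
    rw [← hπ.def] at ih
    filter_upwards [habs, Measure.ae_ae_of_ae_comp ih] with a h1 h2 ha
    rw [pow_succ_apply_eq_lintegral' κ n a hA.compl]
    have h3 : ∀ᵐ b ∂κ a, b ∈ A := by
      rw [ae_iff]; exact h1 ha
    rw [lintegral_eq_zero_iff (Kernel.measurable_coe _ hA.compl)]
    filter_upwards [h2, h3] with b hb hbA using hb hbA

theorem Invariant.measure_eq_zero_of_absorbing (hπ : κ.Invariant π) {S : Set α}
    (hS : ∀ᵐ a ∂π, a ∈ S) {A : Set α} (hA : MeasurableSet A)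
    (habs : ∀ᵐ a ∂π, a ∈ A → κ a Aᶜ = 0) (hacc : ∀ a ∈ S, ∃ n : ℕ, 0 < (κ ^ n) a Aᶜ) :
    π A = 0 := by
  rw [measure_eq_zero_iff_ae_notMem]
  filter_upwards [hS, ae_all_iff.2 (hπ.ae_pow_compl_eq_zero hA habs)] with a haS ha haA
  obtain ⟨n, hn⟩ := hacc a haS
  exact hn.ne' (ha n haA)

/-- Under reversibility the stationary flow from A to its complement equals the flow back, so both
vanish together. -/
theorem IsReversible.absorbing_compl (hπ : κ.IsReversible π) {A : Set α} (hA : MeasurableSet A)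
    (habs : ∀ᵐ a ∂π, a ∈ A → κ a Aᶜ = 0) : ∀ᵐ a ∂π, a ∈ Aᶜ → κ a A = 0 := by
  have h := hπ hA hA.compl
  rw [(setLIntegral_eq_zero_iff hA (Kernel.measurable_coe _ hA.compl)).2 habs] at h
  exact (setLIntegral_eq_zero_iff hA.compl (Kernel.measurable_coe _ hA)).1 h.symm

/-- Sublevel sets of harmonic functions are absorbing. -/
theorem Invariant.absorbing_sublevel [IsProbabilityMeasure π] [IsMarkovKernel κ]
    (hπ : κ.Invariant π) {v : α → ℝ≥0∞} (hv : Measurable v) (hv1 : ∀ a, v a ≤ 1)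
    (hharm : ∀ a, v a = ∫⁻ b, v b ∂κ a) (c : ℝ≥0∞) :
    ∀ᵐ a ∂π, v a ≤ c → κ a {b | v b ≤ c}ᶜ = 0 := by
  have hw : Measurable fun a => v a - c := hv.sub_const c
  -- Subtraction is truncated: this says that (v − c)⁺ is subharmonic. Invariance equates the
  -- π-integrals of both sides, so equality holds a.e., and where v ≤ c the average of (v − c)⁺ is
  -- zero.
  have hle : ∀ a, v a - c ≤ ∫⁻ b, (v b - c) ∂κ a := fun a => by
    conv_lhs => rw [hharm a]
    simpa using lintegral_sub_le (μ := κ a) (fun _ => c) v measurable_const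
  have hfin : ∫⁻ a, (v a - c) ∂π ≠ ∞ := by
    refine ne_top_of_le_ne_top ENNReal.one_ne_top ?_
    calc ∫⁻ a, (v a - c) ∂π ≤ ∫⁻ _, 1 ∂π := lintegral_mono fun a => tsub_le_self.trans (hv1 a)
      _ = 1 := by simp
  have heq : ∫⁻ a, ∫⁻ b, (v b - c) ∂κ a ∂π = ∫⁻ a, (v a - c) ∂π := by
    rw [← Measure.lintegral_bind (Kernel.aemeasurable _) hw.aemeasurable, hπ.def]
  filter_upwards [ae_eq_of_ae_le_of_lintegral_le (ae_of_all _ hle) hfin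
    hw.lintegral_kernel.aemeasurable heq.le] with a ha hac
  rw [tsub_eq_zero_of_le hac] at ha
  have h0 := (lintegral_eq_zero_iff hw).1 ha.symm
  have h1 : ∀ᵐ b ∂κ a, v b ≤ c := h0.mono fun b hb => tsub_eq_zero_iff_le.1 hb
  exact ae_iff.1 h1

/-- A bounded harmonic function of an irreducible reversible chain is almost everywhere constant. -/
theorem IsReversible.ae_eq_const_of_harmonic [IsProbabilityMeasure π] [IsMarkovKernel κ]
    (hπ : κ.IsReversible π) {S : Set α} (hS : ∀ᵐ a ∂π, a ∈ S) (hirr : IsIrreducibleOn S κ)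
    {v : α → ℝ≥0∞} (hv : Measurable v) (hv1 : ∀ a, v a ≤ 1)
    (hharm : ∀ a, v a = ∫⁻ b, v b ∂κ a) : ∃ c, ∀ᵐ a ∂π, v a = c := by
  obtain ⟨φ, -, hφ0, hφ⟩ := hirr
  set c := ∫⁻ a, v a ∂π with hc
  have hcfin : c ≠ ∞ := by
    refine ne_top_of_le_ne_top ENNReal.one_ne_top ?_
    calc ∫⁻ a, v a ∂π ≤ ∫⁻ _, 1 ∂π := lintegral_mono hv1
      _ = 1 := by simp
  have hc' : ∫⁻ _, c ∂π = c := by simp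
  set A : Set α := {a | v a ≤ c} with hAdef
  have hA : MeasurableSet A := measurableSet_le hv measurable_const
  have habs : ∀ᵐ a ∂π, a ∈ A → κ a Aᶜ = 0 := hπ.invariant.absorbing_sublevel hv hv1 hharm c
  refine ⟨c, ?_⟩
  -- φ charges A or its complement. The charged set is reachable from all of S, so the other one,
  -- being absorbing, is π-null. Hence v lies a.e. on one side of its mean c and equals it.
  by_cases h : φ Aᶜ = 0
  · have hpos : 0 < φ A := by
      refine pos_iff_ne_zero.2 fun h' => hφ0 (Measure.measure_univ_eq_zero.1 ?_)
      rw [← Set.union_compl_self A]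
      exact measure_union_null h' h
    have h0 : π Aᶜ = 0 := hπ.invariant.measure_eq_zero_of_absorbing hS hA.compl
      (by simpa using hπ.absorbing_compl hA habs) (by simpa using hφ A hA hpos)
    refine ae_eq_of_ae_le_of_lintegral_le (μ := π) (f := v) (g := fun _ => c) ?_ hcfin
      aemeasurable_const hc'.le
    filter_upwards [measure_eq_zero_iff_ae_notMem.1 h0] with a ha
    exact Set.notMem_compl_iff.1 ha
  · have h0 : π A = 0 := hπ.invariant.measure_eq_zero_of_absorbing hS hA habs
      (hφ Aᶜ hA.compl (pos_iff_ne_zero.2 h))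
    have := ae_eq_of_ae_le_of_lintegral_le (μ := π) (f := fun _ => c) (g := v) ?_
      (by rw [hc']; exact hcfin) hv.aemeasurable hc'.ge
    · filter_upwards [this] with a ha using ha.symm
    · filter_upwards [measure_eq_zero_iff_ae_notMem.1 h0] with a ha
      exact (not_le.1 ha).le

/-- If a state of an irreducible reversible chain is absorbing, then the chain never leaves it
under the invariant distribution. -/
theorem IsReversible.measure_compl_singleton_eq_zero [MeasurableSingletonClass α]
    [IsMarkovKernel κ] (hπ : κ.IsReversible π) {S : Set α} (hS : ∀ᵐ a ∂π, a ∈ S)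
    (hirr : IsIrreducibleOn S κ) {a : α} (ha : a ∈ S) (hκ : κ a = Measure.dirac a) :
    π {a}ᶜ = 0 := by
  obtain ⟨φ, -, hφ0, hφ⟩ := hirr
  have hm : MeasurableSet ({a} : Set α) := measurableSet_singleton a
  have hpow : ∀ n : ℕ, (κ ^ n) a = Measure.dirac a := by
    intro n
    induction n with
    | zero => rfl
    | succ n ih =>
      ext s hs
      rw [pow_succ_apply_eq_lintegral' κ n a hs, hκ, lintegral_dirac' _ (Kernel.measurable_coe _ hs),
        ih]
  -- The chain never leaves a, so φ lives on {a}. The complement of {a} is absorbing by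
  -- reversibility, yet {a} is reachable from S.
  have h0 : φ {a}ᶜ = 0 := by
    by_contra h
    obtain ⟨n, hn⟩ := hφ _ hm.compl (pos_iff_ne_zero.2 h) a ha
    rw [hpow, Measure.dirac_apply' _ hm.compl] at hn
    simp at hn
  have hpos : 0 < φ {a} := by
    refine pos_iff_ne_zero.2 fun h' => hφ0 (Measure.measure_univ_eq_zero.1 ?_)
    rw [← Set.union_compl_self {a}]
    exact measure_union_null h' h0
  refine hπ.invariant.measure_eq_zero_of_absorbing hS hm.compl ?_ (by simpa using hφ _ hm hpos)
  have := hπ.absorbing_compl hm (ae_of_all _ fun b (hb : b = a) => by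
    rw [hb, hκ, Measure.dirac_apply' _ hm.compl]; simp)
  simpa using this

end Absorbing

end ProbabilityTheory.Kernel

/-! ### First hitting times of i.i.d. sequences. -/

section FirstTime

theorem firstTime_eq_coe_add_one_iff {b : ℕ → Prop} {i : ℕ} :
    firstTime b = (i : ℕ∞) + 1 ↔ b i ∧ ∀ j < i, ¬ b j := by
  classical
  have hle : ∀ {k : ℕ}, b k → firstTime b ≤ (k : ℕ∞) + 1 := fun {k} hk => iInf₂_le k hk
  have hge : ∀ {k : ℕ}, (∀ j < k, ¬ b j) → (k : ℕ∞) + 1 ≤ firstTime b := fun {k} hk =>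
    le_iInf₂ fun j hj => by
      have : k ≤ j := not_lt.1 fun h => hk j h hj
      gcongr
  constructor
  · intro h
    by_cases hb : ∃ k, b k
    · have hk : firstTime b = (Nat.find hb : ℕ∞) + 1 :=
        (hle (Nat.find_spec hb)).antisymm (hge fun j hj => Nat.find_min hb hj)
      have : i = Nat.find hb := by
        rw [h] at hk
        have : i + 1 = Nat.find hb + 1 := by exact_mod_cast hk
        omega
      rw [this]
      exact ⟨Nat.find_spec hb, fun j hj => Nat.find_min hb hj⟩
    · push Not at hb
      have : firstTime b = ⊤ := by simp [firstTime, hb]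
      rw [this] at h
      exact absurd h (by exact_mod_cast ENat.top_ne_natCast (i + 1))
  · rintro ⟨h1, h2⟩
    exact (hle h1).antisymm (hge h2)

-- The tail-sum formula: time i + 1 belongs to index i, so the i-th summand is the indicator of
-- {time > i}. It also covers the value ⊤.
open Classical in
theorem toENNReal_firstTime (b : ℕ → Prop) :
    ((firstTime b : ℕ∞) : ℝ≥0∞) = ∑' i : ℕ, if ∀ j < i, ¬ b j then 1 else 0 := by
  by_cases hb : ∃ k, b k
  · have hk : firstTime b = (Nat.find hb : ℕ∞) + 1 :=
      firstTime_eq_coe_add_one_iff.2 ⟨Nat.find_spec hb, fun j hj => Nat.find_min hb hj⟩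
    have hiff : ∀ i, (∀ j < i, ¬ b j) ↔ i ∈ Finset.range (Nat.find hb + 1) := fun i => by
      rw [Finset.mem_range, Nat.lt_succ_iff]
      exact ⟨fun h => not_lt.1 fun hlt => h _ hlt (Nat.find_spec hb),
        fun h j hj => Nat.find_min hb (hj.trans_le h)⟩
    rw [hk, tsum_eq_sum (s := Finset.range (Nat.find hb + 1)) fun i hi => if_neg fun h =>
      hi ((hiff i).1 h), Finset.sum_congr rfl fun i hi => if_pos ((hiff i).2 hi)]
    simp
  · push Not at hb
    have : firstTime b = ⊤ := by simp [firstTime, hb]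
    rw [this, ENat.toENNReal_top]
    simp [hb]

variable {α : Type*} [MeasurableSpace α] (μ : Measure α) [IsProbabilityMeasure μ]

theorem infinitePi_forall_lt_and {W V : Set α} (hW : MeasurableSet W) (hV : MeasurableSet V)
    (i : ℕ) :
    Measure.infinitePi (fun _ : ℕ => μ) {s | (∀ j < i, s j ∈ W) ∧ s i ∈ V} = μ W ^ i * μ V := by
  have hs : {s : ℕ → α | (∀ j < i, s j ∈ W) ∧ s i ∈ V} =
      (Finset.range (i + 1) : Set ℕ).pi fun j => if j < i then W else V := by
    ext s
    simp only [Set.mem_ofPred_eq, Set.mem_pi, Finset.coe_range, Set.mem_Iio]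
    refine ⟨fun h j hj => ?_, fun h => ⟨fun j hj => ?_, ?_⟩⟩
    · split_ifs with hji
      · exact h.1 j hji
      · rw [show j = i by omega]; exact h.2
    · simpa [hj] using h j (by omega)
    · simpa using h i (by omega)
  rw [hs, Measure.infinitePi_pi (fun _ : ℕ => μ) fun j _ => by split_ifs <;> assumption,
    Finset.prod_range_succ, Finset.prod_congr rfl (g := fun _ => μ W) fun j hj => by
      rw [if_pos (Finset.mem_range.1 hj)]]
  simp

theorem infinitePi_forall_lt {W : Set α} (hW : MeasurableSet W) (i : ℕ) :
    Measure.infinitePi (fun _ : ℕ => μ) {s | ∀ j < i, s j ∈ W} = μ W ^ i := by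
  simpa using infinitePi_forall_lt_and μ hW .univ i

/-- The tails form a geometric series; if U is null, both sides are infinite. -/
theorem lintegral_firstTime_infinitePi {U : Set α} (hU : MeasurableSet U) :
    ∫⁻ s : ℕ → α, (firstTime fun i => s i ∈ U : ℕ∞) ∂(Measure.infinitePi fun _ : ℕ => μ) =
      (1 - μ Uᶜ)⁻¹ := by
  classical
  have hm : ∀ i : ℕ, MeasurableSet {s : ℕ → α | ∀ j < i, s j ∉ U} := fun i => by
    simp only [Set.ofPred_forall]
    exact MeasurableSet.iInter fun j => MeasurableSet.iInter fun _ =>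
      hU.compl.preimage (measurable_pi_apply j)
  simp_rw [toENNReal_firstTime]
  rw [lintegral_tsum fun i => (Measurable.ite (hm i) measurable_const measurable_const).aemeasurable,
    ← ENNReal.tsum_geometric]
  refine tsum_congr fun i => ?_
  rw [← infinitePi_forall_lt μ hU.compl i]
  have := lintegral_indicator_one (μ := Measure.infinitePi fun _ : ℕ => μ) (hm i)
  simpa only [Set.indicator, Set.mem_ofPred_eq, Pi.one_apply, Set.mem_compl_iff] using this

/-- Since V ⊆ U, the event splits according to the stopping index i, with probabilities μ(Uᶜ)^i
μ(V). -/
theorem infinitePi_firstTime_mem {U V : Set α} (hU : MeasurableSet U) (hV : MeasurableSet V)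
    (hVU : V ⊆ U) :
    Measure.infinitePi (fun _ : ℕ => μ)
        {s | ∃ i : ℕ, (firstTime fun i => s i ∈ U) = (i : ℕ∞) + 1 ∧ s i ∈ V} =
      μ V * (1 - μ Uᶜ)⁻¹ := by
  have hs : {s : ℕ → α | ∃ i : ℕ, (firstTime fun i => s i ∈ U) = (i : ℕ∞) + 1 ∧ s i ∈ V} =
      ⋃ i : ℕ, {s | (∀ j < i, s j ∈ Uᶜ) ∧ s i ∈ V} := by
    ext s
    simp only [Set.mem_ofPred_eq, Set.mem_iUnion, firstTime_eq_coe_add_one_iff]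
    exact exists_congr fun i => ⟨fun h => ⟨h.1.2, h.2⟩, fun h => ⟨⟨hVU h.2, h.1⟩, h.2⟩⟩
  rw [hs, measure_iUnion, ← ENNReal.tsum_geometric, ← ENNReal.tsum_mul_left]
  · exact tsum_congr fun i => by rw [infinitePi_forall_lt_and μ hU.compl hV, mul_comm]
  · intro i k hik
    refine Set.disjoint_left.2 fun s hi hk => ?_
    rcases lt_or_gt_of_ne hik with h | h
    · exact hk.1 i h (hVU hi.2)
    · exact hi.1 k h (hVU hk.2)
  · intro i
    simp only [Set.ofPred_and, Set.ofPred_forall]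
    exact (MeasurableSet.iInter fun j => MeasurableSet.iInter fun _ =>
      (measurable_pi_apply j) hU.compl).inter ((measurable_pi_apply i) hV)

end FirstTime

theorem volume_unitInterval_Iic {a : ℝ≥0} (ha : a ≤ 1) :
    (volume : Measure unitInterval) {u | (u : ℝ) ≤ a} = a := by
  have := unitInterval.volume_Iic ⟨(a : ℝ), a.2, ha⟩
  rw [show {u : unitInterval | (u : ℝ) ≤ a} = Set.Iic ⟨(a : ℝ), a.2, ha⟩ from rfl, this]
  simp

/-! ### One iteration of the 1-hit algorithm: explicit kernel, reversibility and expected cost. -/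

namespace ABCModel

section Step

variable {Θ Y : Type*} [MeasurableSpace Θ] [MetricSpace Y] [MeasurableSpace Y]
  (M : ABCModel Θ Y)

theorem setOf_hit : {x | M.Hit x} = Metric.closedBall M.y M.ε := by
  ext x; simp [Hit, dist_comm]

theorem h_le_one (θ : Θ) : M.h θ ≤ 1 := prob_le_one

/-- The expected number of simulated pairs when the parameters `θ` and `ϑ` race to a first hit. -/
noncomputable def raceTime (θ ϑ : Θ) : ℝ≥0∞ := (1 - (1 - M.h θ) * (1 - M.h ϑ))⁻¹

/-- The probability that the simulation from `ϑ` is a hit when the race between `θ` and `ϑ`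
stops. -/
noncomputable def raceProb (θ ϑ : Θ) : ℝ≥0∞ := M.h ϑ * M.raceTime θ ϑ

theorem raceTime_comm (θ ϑ : Θ) : M.raceTime θ ϑ = M.raceTime ϑ θ := by
  rw [raceTime, raceTime, mul_comm]

theorem raceTime_le (θ ϑ : Θ) : M.raceTime θ ϑ ≤ (M.h θ)⁻¹ := by
  refine ENNReal.inv_le_inv.2 ?_
  calc M.h θ = 1 - (1 - M.h θ) := (ENNReal.sub_sub_cancel ENNReal.one_ne_top (M.h_le_one θ)).symm
    _ ≤ 1 - (1 - M.h θ) * (1 - M.h ϑ) :=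
      tsub_le_tsub_left (mul_le_of_le_one_right' tsub_le_self) _

theorem h_mul_raceTime_le_one (θ ϑ : Θ) : M.h θ * M.raceTime θ ϑ ≤ 1 :=
  (mul_le_mul_right (M.raceTime_le θ ϑ) _).trans (ENNReal.mul_inv_le_one _)

theorem raceProb_le_one (θ ϑ : Θ) : M.raceProb θ ϑ ≤ 1 := by
  rw [raceProb, raceTime_comm]
  exact M.h_mul_raceTime_le_one ϑ θ

theorem simulations_apply (θ ϑ : Θ) :
    M.simulations (θ, ϑ) = Measure.infinitePi fun _ : ℕ => (M.f θ).prod (M.f ϑ) := by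
  change (Measure.infinitePi fun _ : ℕ =>
    ((M.f.comap Prod.fst measurable_fst) ×ₖ (M.f.comap Prod.snd measurable_snd)) (θ, ϑ)) = _
  simp_rw [Kernel.prod_apply, Kernel.comap_apply]

theorem passProb_le_one (θ ϑ : Θ) : M.passProb θ ϑ ≤ 1 := min_le_left _ _

/-- The Metropolis–Hastings symmetrization. If c(θ, ϑ) = 0, both sides vanish, whatever value the
quotient takes. -/
theorem p_mul_q_mul_passProb (θ ϑ : Θ) :
    M.p θ * (M.q θ ϑ * M.passProb θ ϑ) = min (M.c θ ϑ) (M.c ϑ θ) := by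
  rw [← mul_assoc]
  change M.c θ ϑ * min 1 (M.c ϑ θ / M.c θ ϑ) = _
  rcases eq_or_ne (M.c θ ϑ) 0 with h | h
  · simp [h]
  · rw [mul_min, mul_one, mul_div_cancel₀ _ h]

open Classical in
/-- The result of an iteration that passes the prior-proposal step. -/
noncomputable def raceUpdate (θ ϑ : Θ) (s : ℕ → Y × Y) : Θ × ℕ∞ :=
  (if M.ProposedHits s then ϑ else θ, M.pairsUntilHit s)

/-- The density of the accepted moves. -/
noncomputable def moveDensity (θ ϑ : Θ) : ℝ≥0∞ :=
  M.q θ ϑ * (M.passProb θ ϑ * M.raceProb θ ϑ)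

/-- The probability of staying at `θ`, apart from accepted moves to `θ` itself. -/
noncomputable def stayProb (θ : Θ) : ℝ≥0∞ :=
  ∫⁻ ϑ, M.q θ ϑ * (1 - M.passProb θ ϑ * M.raceProb θ ϑ) ∂M.base

theorem measurable_q_ennreal : Measurable fun d : Θ × Θ => (M.q d.1 d.2 : ℝ≥0∞) :=
  M.measurable_q.coe_nnreal_ennreal

theorem measurable_passProb_ennreal : Measurable fun d : Θ × Θ => (M.passProb d.1 d.2 : ℝ≥0∞) :=
  M.measurable_passProb.coe_nnreal_ennreal

/-- The unnormalized density of the approximate posterior. -/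
noncomputable def weight (θ : Θ) : ℝ≥0∞ := M.p θ * M.h θ

/-- Detailed balance: the winning probability h(ϑ)·`raceTime`, times the posterior factor h(θ), is
symmetric, because `raceTime` is. -/
theorem weight_mul_moveDensity_comm (θ ϑ : Θ) :
    M.weight θ * M.moveDensity θ ϑ = M.weight ϑ * M.moveDensity ϑ θ := by
  have key : ∀ θ ϑ, M.weight θ * M.moveDensity θ ϑ =
      ((min (M.c θ ϑ) (M.c ϑ θ) : ℝ≥0) : ℝ≥0∞) * (M.h θ * M.h ϑ * M.raceTime θ ϑ) := by
    intro θ ϑ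
    rw [← p_mul_q_mul_passProb, weight, moveDensity, raceProb]
    push_cast
    ring
  rw [key, key, min_comm, M.raceTime_comm θ ϑ, mul_comm (M.h θ)]

/-- The approximate posterior distribution. -/
noncomputable def posterior : Measure Θ := M.H⁻¹ • M.base.withDensity M.weight

theorem lintegral_p [IsProbabilityMeasure M.prior] : ∫⁻ θ, M.p θ ∂M.base = 1 := by
  have := measure_univ (μ := M.prior)
  rwa [prior, withDensity_apply _ .univ, Measure.restrict_univ] at this

theorem H_le_one [IsProbabilityMeasure M.prior] : M.H ≤ 1 := by
  rw [← M.lintegral_p, H]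
  exact lintegral_mono fun θ => mul_le_of_le_one_right' (M.h_le_one θ)

theorem posterior_absolutelyContinuous : M.posterior ≪ M.base.withDensity M.weight :=
  Measure.AbsolutelyContinuous.smul_left .rfl _

theorem isProbabilityMeasure_posterior [IsProbabilityMeasure M.prior] (hH : 0 < M.H) :
    IsProbabilityMeasure M.posterior := by
  refine ⟨?_⟩
  rw [posterior, Measure.smul_apply, withDensity_apply _ .univ, Measure.restrict_univ]
  exact ENNReal.inv_mul_cancel hH.ne' (ne_top_of_le_ne_top ENNReal.one_ne_top M.H_le_one)

theorem lintegral_draws {g : Θ × unitInterval × (ℕ → Y × Y) → ℝ≥0∞} (hg : Measurable g) (θ : Θ) :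
    ∫⁻ d, g d ∂M.draws θ = ∫⁻ ϑ, M.q θ ϑ *
      ∫⁻ u : unitInterval, ∫⁻ s, g (ϑ, u, s) ∂M.simulations (θ, ϑ) ∂volume ∂M.base := by
  have hq : Measurable (Function.uncurry fun θ ϑ => (M.q θ ϑ : ℝ≥0∞)) :=
    M.measurable_q.coe_nnreal_ennreal
  have h1 : Measurable fun ϑ => ∫⁻ us, g (ϑ, us)
      ∂((Kernel.const (Θ × Θ) (volume : Measure unitInterval)) ×ₖ M.simulations) (θ, ϑ) :=
    Measurable.lintegral_kernel_prod_right'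
      (κ := ((Kernel.const (Θ × Θ) (volume : Measure unitInterval)) ×ₖ M.simulations).comap
        (fun ϑ => (θ, ϑ)) measurable_prodMk_left) hg
  have hg' : ∀ ϑ, Measurable fun us => g (ϑ, us) := fun ϑ => hg.comp measurable_prodMk_left
  rw [draws, Kernel.lintegral_compProd _ _ _ hg, proposal,
    Kernel.lintegral_withDensity _ hq _ h1, Kernel.const_apply]
  refine lintegral_congr fun ϑ => ?_
  congr 1
  rw [Kernel.prod_apply, Kernel.const_apply,
    lintegral_prod _ (hg' ϑ).aemeasurable]

variable [BorelSpace Y]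

theorem measurable_h : Measurable M.h :=
  M.f.measurable_coe Metric.isClosed_closedBall.measurableSet

theorem measurable_raceTime : Measurable fun d : Θ × Θ => M.raceTime d.1 d.2 := by
  have := M.measurable_h
  unfold raceTime
  fun_prop

theorem measurable_raceProb : Measurable fun d : Θ × Θ => M.raceProb d.1 d.2 :=
  (M.measurable_h.comp measurable_snd).mul M.measurable_raceTime

theorem prod_compl_hit (θ ϑ : Θ) :
    (M.f θ).prod (M.f ϑ) {d | M.Hit d.1 ∨ M.Hit d.2}ᶜ = (1 - M.h θ) * (1 - M.h ϑ) := by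
  have : {d : Y × Y | M.Hit d.1 ∨ M.Hit d.2}ᶜ = {x | M.Hit x}ᶜ ×ˢ {x | M.Hit x}ᶜ := by
    ext d; simp
  rw [this, Measure.prod_prod, prob_compl_eq_one_sub M.measurableSet_hit,
    prob_compl_eq_one_sub M.measurableSet_hit, setOf_hit]
  rfl

theorem measurableSet_hit_or_hit : MeasurableSet {d : Y × Y | M.Hit d.1 ∨ M.Hit d.2} :=
  (M.measurableSet_hit.preimage measurable_fst).union (M.measurableSet_hit.preimage measurable_snd)

theorem lintegral_pairsUntilHit (θ ϑ : Θ) :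
    ∫⁻ s, (M.pairsUntilHit s : ℝ≥0∞) ∂M.simulations (θ, ϑ) = M.raceTime θ ϑ := by
  rw [simulations_apply, raceTime, ← prod_compl_hit]
  exact lintegral_firstTime_infinitePi _ M.measurableSet_hit_or_hit

theorem simulations_proposedHits (θ ϑ : Θ) :
    M.simulations (θ, ϑ) {s | M.ProposedHits s} = M.raceProb θ ϑ := by
  have hV : MeasurableSet {d : Y × Y | M.Hit d.2} := M.measurableSet_hit.preimage measurable_snd
  have hVp : (M.f θ).prod (M.f ϑ) {d | M.Hit d.2} = M.h ϑ := by
    rw [show {d : Y × Y | M.Hit d.2} = Set.univ ×ˢ {x | M.Hit x} by ext; simp, Measure.prod_prod,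
      setOf_hit, measure_univ, one_mul]
    rfl
  rw [simulations_apply, raceProb, raceTime, ← prod_compl_hit, ← hVp]
  exact infinitePi_firstTime_mem _ M.measurableSet_hit_or_hit hV fun d hd => Or.inr hd

theorem lintegral_oneHitStep {g : Θ × ℕ∞ → ℝ≥0∞} (hg : Measurable g) (θ : Θ) :
    ∫⁻ x, g x ∂M.oneHitStep θ = ∫⁻ ϑ, M.q θ ϑ * ((1 - M.passProb θ ϑ) * g (θ, 0) +
      M.passProb θ ϑ * ∫⁻ s, g (M.raceUpdate θ ϑ s) ∂M.simulations (θ, ϑ)) ∂M.base := by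
  have hgu : Measurable fun d => g (M.oneHitUpdate d) := hg.comp M.measurable_oneHitUpdate
  have hgθ : Measurable fun d => g (M.oneHitUpdate (θ, d)) := hgu.comp measurable_prodMk_left
  rw [oneHitStep, Kernel.map_apply _ M.measurable_oneHitUpdate,
    lintegral_map hg M.measurable_oneHitUpdate, Kernel.prod_apply, Kernel.id_apply,
    lintegral_prod _ hgu.aemeasurable, lintegral_dirac' _ hgu.lintegral_prod_right',
    M.lintegral_draws hgθ]
  refine lintegral_congr fun ϑ => ?_
  congr 1
  set a := M.passProb θ ϑ with ha
  have hm : MeasurableSet {u : unitInterval | (u : ℝ) ≤ a} :=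
    measurableSet_le measurable_subtype_coe measurable_const
  rw [← lintegral_add_compl _ hm, add_comm]
  congr 1
  · rw [setLIntegral_congr_fun (g := fun _ => g (θ, 0)) hm.compl fun u hu => ?_,
      setLIntegral_const, prob_compl_eq_one_sub hm, volume_unitInterval_Iic (M.passProb_le_one θ ϑ),
      mul_comm]
    have : (a : ℝ) < u := not_le.1 hu
    simp [oneHitUpdate, ← ha, this]
  · rw [setLIntegral_congr_fun (g := fun _ => ∫⁻ s, g (M.raceUpdate θ ϑ s) ∂M.simulations (θ, ϑ)) hm
      fun u hu => ?_, setLIntegral_const, volume_unitInterval_Iic (M.passProb_le_one θ ϑ), mul_comm]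
    have : ¬ (a : ℝ) < u := not_lt.2 hu
    simp [oneHitUpdate, ← ha, this, raceUpdate]

theorem measurable_moveDensity : Measurable fun d : Θ × Θ => M.moveDensity d.1 d.2 :=
  M.measurable_q_ennreal.mul (M.measurable_passProb_ennreal.mul M.measurable_raceProb)

theorem measurable_stayDensity :
    Measurable fun d : Θ × Θ => (M.q d.1 d.2 : ℝ≥0∞) * (1 - M.passProb d.1 d.2 * M.raceProb d.1 d.2) :=
  M.measurable_q_ennreal.mul
    ((M.measurable_passProb_ennreal.mul M.measurable_raceProb).const_sub 1)

theorem measurable_stayProb : Measurable M.stayProb :=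
  M.measurable_stayDensity.lintegral_prod_right'

theorem lintegral_raceUpdate_fst (v : Θ → ℝ≥0∞) (θ ϑ : Θ) :
    ∫⁻ s, v (M.raceUpdate θ ϑ s).1 ∂M.simulations (θ, ϑ) =
      M.raceProb θ ϑ * v ϑ + (1 - M.raceProb θ ϑ) * v θ := by
  have hm := M.measurableSet_proposedHits
  rw [← lintegral_add_compl _ hm]
  congr 1
  · rw [setLIntegral_congr_fun (g := fun _ => v ϑ) hm fun s hs => ?_, setLIntegral_const,
      simulations_proposedHits, mul_comm]
    simp [raceUpdate, show M.ProposedHits s from hs]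
  · rw [setLIntegral_congr_fun (g := fun _ => v θ) hm.compl fun s hs => ?_, setLIntegral_const,
      prob_compl_eq_one_sub hm, simulations_proposedHits, mul_comm]
    simp [raceUpdate, show ¬ M.ProposedHits s from hs]

theorem lintegral_oneHitKernel {v : Θ → ℝ≥0∞} (hv : Measurable v) (θ : Θ) :
    ∫⁻ ϑ, v ϑ ∂M.oneHitKernel θ = ∫⁻ ϑ, M.moveDensity θ ϑ * v ϑ ∂M.base + M.stayProb θ * v θ := by
  have hv' : Measurable fun x : Θ × ℕ∞ => v x.1 := hv.comp measurable_fst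
  have hs : Measurable fun ϑ =>
      (M.q θ ϑ : ℝ≥0∞) * (1 - M.passProb θ ϑ * M.raceProb θ ϑ) :=
    M.measurable_stayDensity.comp measurable_prodMk_left
  have hk : Measurable (M.moveDensity θ) := M.measurable_moveDensity.comp measurable_prodMk_left
  have hkv : Measurable fun ϑ => M.moveDensity θ ϑ * v ϑ := hk.mul hv
  rw [oneHitKernel, Kernel.fst_apply, lintegral_map hv measurable_fst,
    M.lintegral_oneHitStep hv', stayProb, ← lintegral_mul_const _ hs,
    ← lintegral_add_left hkv]
  refine lintegral_congr fun ϑ => ?_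
  have h1 := M.lintegral_raceUpdate_fst v θ ϑ
  simp only [moveDensity]
  rw [h1]
  have ha1 : (M.passProb θ ϑ : ℝ≥0∞) ≤ 1 := by exact_mod_cast M.passProb_le_one θ ϑ
  have hr1 := M.raceProb_le_one θ ϑ
  generalize (M.passProb θ ϑ : ℝ≥0∞) = a at *
  generalize M.raceProb θ ϑ = r at *
  have har : a * (1 - r) = a - a * r := by
    rw [ENNReal.mul_sub fun _ _ => ne_top_of_le_ne_top ENNReal.one_ne_top ha1, mul_one]
  -- The two ways of staying, a rejection in the first step and a lost race, merge into one holding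
  -- probability.
  have hs' : (1 - a) + a * (1 - r) = 1 - a * r := by
    rw [har]
    exact tsub_add_tsub_cancel ha1 (mul_le_of_le_one_right' hr1)
  rw [← hs']
  ring

theorem lintegral_moveDensity_add_stayProb (θ : Θ) :
    ∫⁻ ϑ, M.moveDensity θ ϑ ∂M.base + M.stayProb θ = 1 := by
  have : IsMarkovKernel M.oneHitKernel := by unfold oneHitKernel; infer_instance
  have := M.lintegral_oneHitKernel (v := fun _ => 1) measurable_const θ
  simpa using this.symm

theorem lintegral_pairs_oneHitStep (θ : Θ) :
    ∫⁻ x, (x.2 : ℝ≥0∞) ∂M.oneHitStep θ =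
      ∫⁻ ϑ, M.q θ ϑ * (M.passProb θ ϑ * M.raceTime θ ϑ) ∂M.base := by
  have hm : Measurable fun x : Θ × ℕ∞ => (x.2 : ℝ≥0∞) :=
    (Measurable.of_discrete (f := fun n : ℕ∞ => (n : ℝ≥0∞))).comp measurable_snd
  rw [M.lintegral_oneHitStep hm]
  refine lintegral_congr fun ϑ => ?_
  have := M.lintegral_pairsUntilHit θ ϑ
  simp [raceUpdate, this]

theorem lintegral_pairs_oneHitStep_le (θ : Θ) :
    ∫⁻ x, (x.2 : ℝ≥0∞) ∂M.oneHitStep θ ≤ (M.h θ)⁻¹ := by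
  rw [lintegral_pairs_oneHitStep]
  have hq : Measurable fun ϑ => (M.q θ ϑ : ℝ≥0∞) :=
    M.measurable_q_ennreal.comp measurable_prodMk_left
  calc ∫⁻ ϑ, M.q θ ϑ * (M.passProb θ ϑ * M.raceTime θ ϑ) ∂M.base
      ≤ ∫⁻ ϑ, M.q θ ϑ * (M.h θ)⁻¹ ∂M.base := by
        refine lintegral_mono fun ϑ => mul_le_mul_right ?_ _
        have ha1 : (M.passProb θ ϑ : ℝ≥0∞) ≤ 1 := by exact_mod_cast M.passProb_le_one θ ϑ
        exact (mul_le_of_le_one_left' ha1).trans (M.raceTime_le θ ϑ)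
    _ = (M.h θ)⁻¹ := by
      rw [lintegral_mul_const _ hq,
        M.lintegral_q, one_mul]

theorem measurable_weight : Measurable M.weight :=
  M.measurable_p.coe_nnreal_ennreal.mul M.measurable_h

/-- The accepted moves satisfy detailed balance, and the holding part contributes an integral over A
∩ B, symmetric in A and B. -/
theorem oneHitKernel_isReversible : M.oneHitKernel.IsReversible M.posterior := by
  intro A B hA hB
  have key : ∀ A B : Set Θ, MeasurableSet A → MeasurableSet B →
      ∫⁻ θ in A, M.oneHitKernel θ B ∂M.base.withDensity M.weight =
        ∫⁻ θ in A, ∫⁻ ϑ in B, M.weight θ * M.moveDensity θ ϑ ∂M.base ∂M.base +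
          ∫⁻ θ in A ∩ B, M.weight θ * M.stayProb θ ∂M.base := by
    intro A B hA hB
    have hk : ∀ θ, M.oneHitKernel θ B =
        ∫⁻ ϑ in B, M.moveDensity θ ϑ ∂M.base + B.indicator M.stayProb θ := by
      intro θ
      have := M.lintegral_oneHitKernel (measurable_one.indicator hB) θ
      rw [lintegral_indicator_one hB] at this
      rw [this, ← lintegral_indicator hB]
      congr 1
      · refine lintegral_congr fun ϑ => ?_
        by_cases h : ϑ ∈ B <;> simp [h]
      · by_cases h : θ ∈ B <;> simp [h]
    have hmv : ∀ θ, Measurable (M.moveDensity θ) := fun θ =>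
      M.measurable_moveDensity.comp measurable_prodMk_left
    have hws : Measurable fun θ => M.weight θ * M.stayProb θ :=
      M.measurable_weight.mul M.measurable_stayProb
    rw [restrict_withDensity hA, lintegral_withDensity_eq_lintegral_mul _ M.measurable_weight
      (Kernel.measurable_coe _ hB), Set.inter_comm, ← Measure.restrict_restrict hB,
      ← lintegral_indicator hB, ← lintegral_add_right _
        (hws.indicator hB)]
    refine lintegral_congr fun θ => ?_
    rw [Pi.mul_apply, hk, mul_add, lintegral_const_mul _ (hmv θ)]
    congr 1
    by_cases h : θ ∈ B <;> simp [h]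
  simp only [posterior, Measure.restrict_smul, lintegral_smul_measure]
  rw [key A B hA hB, key B A hB hA, Set.inter_comm]
  congr 2
  rw [lintegral_lintegral_swap]
  · refine lintegral_congr fun ϑ => lintegral_congr fun θ => M.weight_mul_moveDensity_comm θ ϑ
  · exact ((M.measurable_weight.comp measurable_fst).mul M.measurable_moveDensity).aemeasurable

theorem ae_posterior_mem_support : ∀ᵐ θ ∂M.posterior, θ ∈ M.posteriorSupport := by
  refine M.posterior_absolutelyContinuous.ae_le ?_
  change ∀ᵐ θ ∂_, _
  rw [ae_withDensity_iff M.measurable_weight]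
  refine ae_of_all _ fun θ hθ => ?_
  have h1 := left_ne_zero_of_mul hθ
  exact ⟨pos_iff_ne_zero.2 (by exact_mod_cast h1), pos_iff_ne_zero.2 (right_ne_zero_of_mul hθ)⟩

/-- Accepted moves are made to almost all states only, with respect to the posterior. -/
theorem ae_moveDensity_eq_zero_or (hH : M.H ≠ ∞) {P : Θ → Prop} (hP : ∀ᵐ ϑ ∂M.posterior, P ϑ)
    (θ : Θ) : ∀ᵐ ϑ ∂M.base, M.moveDensity θ ϑ ≠ 0 → P ϑ := by
  rw [posterior, Measure.ae_ennreal_smul_measure_iff (ENNReal.inv_ne_zero.2 hH),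
    ae_withDensity_iff M.measurable_weight] at hP
  filter_upwards [hP] with ϑ h hk
  -- A positive move density forces p(ϑ) > 0 through c(ϑ, θ) in `passProb`, and h(ϑ) > 0 through
  -- `raceProb`.
  refine h (mul_ne_zero ?_ ?_)
  · have h1 : M.passProb θ ϑ ≠ 0 := fun h => hk (by simp [moveDensity, h])
    intro h0
    have h0' : M.p ϑ = 0 := by exact_mod_cast h0
    exact h1 (by simp [passProb, c, h0'])
  · exact fun h => hk (by simp [moveDensity, raceProb, h])

/-- Pointwise, p·h·E[N | θ] ≤ p·h·h⁻¹ ≤ p, also where h = 0 since 0·∞ = 0; then p integrates to 1.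
-/
theorem lintegral_pairs_posterior_le [IsProbabilityMeasure M.prior] :
    ∫⁻ θ, ∫⁻ x, (x.2 : ℝ≥0∞) ∂M.oneHitStep θ ∂M.posterior ≤ M.H⁻¹ := by
  have hm : Measurable fun x : Θ × ℕ∞ => (x.2 : ℝ≥0∞) :=
    (Measurable.of_discrete (f := fun n : ℕ∞ => (n : ℝ≥0∞))).comp measurable_snd
  rw [posterior, lintegral_smul_measure, smul_eq_mul]
  refine mul_le_of_le_one_right' ?_
  rw [lintegral_withDensity_eq_lintegral_mul _ M.measurable_weight hm.lintegral_kernel,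
    ← M.lintegral_p]
  refine lintegral_mono fun θ => ?_
  rw [Pi.mul_apply, weight, mul_assoc]
  refine mul_le_of_le_one_right' ?_
  exact (mul_le_mul_right (M.lintegral_pairs_oneHitStep_le θ) _).trans (ENNReal.mul_inv_le_one _)

theorem rejectionCost_eq [IsProbabilityMeasure M.prior] : M.rejectionCost = M.H⁻¹ := by
  have hm : MeasurableSet {d : Θ × Y | M.Hit d.2} := M.measurableSet_hit.preimage measurable_snd
  have hp : (M.prior ⊗ₘ M.f) {d | M.Hit d.2} = M.H := by
    rw [Measure.compProd_apply hm, prior, lintegral_withDensity_eq_lintegral_mul _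
      M.measurable_p.coe_nnreal_ennreal (Kernel.measurable_kernel_prodMk_left hm), H]
    refine lintegral_congr fun θ => ?_
    rw [Pi.mul_apply]
    congr 1
    change M.f θ {x | M.Hit x} = _
    rw [setOf_hit]
    rfl
  have := lintegral_firstTime_infinitePi (M.prior ⊗ₘ M.f) hm
  rw [prob_compl_eq_one_sub hm, hp, ENNReal.sub_sub_cancel ENNReal.one_ne_top M.H_le_one] at this
  exact this

end Step

end ABCModel

theorem iterate_seqShift_apply {X : Type*} (ω : ℕ → X) (i j : ℕ) :
    (seqShift^[i] ω) j = ω (i + j) := by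
  induction i generalizing ω with
  | zero => simp
  | succ i ih =>
    rw [Function.iterate_succ_apply, ih, seqShift]
    congr 1
    omega

/-- Averages of extended nonnegative numbers converge if those of the shifted sequence do and the
first term is finite. -/
theorem ENNReal.tendsto_average_of_shift {a : ℕ → ℝ≥0∞} {n : ℝ≥0∞} (ha : a 0 ≠ ∞)
    (hn : n ≠ ∞)
    (h : Tendsto (fun m : ℕ => (∑ i ∈ Finset.range m, a (i + 1)) / m) atTop (𝓝 n)) :
    Tendsto (fun m : ℕ => (∑ i ∈ Finset.range m, a i) / m) atTop (𝓝 n) := by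
  rw [← tendsto_add_atTop_iff_nat 1]
  have hinv : Tendsto (fun m : ℕ => ((m + 1 : ℕ) : ℝ≥0∞)⁻¹) atTop (𝓝 0) :=
    (tendsto_add_atTop_iff_nat 1).2 ENNReal.tendsto_inv_nat_nhds_zero
  have h0 : Tendsto (fun m : ℕ => a 0 * ((m + 1 : ℕ) : ℝ≥0∞)⁻¹) atTop (𝓝 0) := by
    simpa using ENNReal.Tendsto.const_mul hinv (Or.inr ha)
  have h1 : Tendsto (fun m : ℕ => 1 - ((m + 1 : ℕ) : ℝ≥0∞)⁻¹) atTop (𝓝 1) := by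
    simpa using ENNReal.Tendsto.sub tendsto_const_nhds hinv (Or.inl ENNReal.one_ne_top)
  -- The average of m + 1 terms is a₀/(m + 1) plus the shifted average of m terms times m/(m + 1) =
  -- 1 − 1/(m + 1).
  have h2 := ENNReal.Tendsto.mul h (Or.inr ENNReal.one_ne_top) h1 (Or.inr hn)
  have h3 := h0.add h2
  rw [zero_add, mul_one] at h3
  refine h3.congr' ?_
  filter_upwards [eventually_ge_atTop 1] with m hm
  have hm0 : (m : ℝ≥0∞) ≠ 0 := by exact_mod_cast (Nat.one_le_iff_ne_zero.1 hm)
  have hm1 : ((m + 1 : ℕ) : ℝ≥0∞) ≠ 0 := by exact_mod_cast m.succ_ne_zero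
  have hk : 1 - ((m + 1 : ℕ) : ℝ≥0∞)⁻¹ = m * ((m + 1 : ℕ) : ℝ≥0∞)⁻¹ := by
    refine ENNReal.sub_eq_of_eq_add (ENNReal.inv_ne_top.2 hm1) ?_
    rw [← ENNReal.mul_inv_cancel hm1 (ENNReal.natCast_ne_top _)]
    push_cast
    ring
  rw [hk, Finset.sum_range_succ', div_eq_mul_inv, div_eq_mul_inv, add_mul, add_comm]
  congr 1
  rw [mul_assoc, ← mul_assoc _ (m : ℝ≥0∞), ENNReal.inv_mul_cancel hm0 (ENNReal.natCast_ne_top _),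
    one_mul]

/-! ### The law of large numbers, first in stationarity and then from every state of the support. -/

namespace ABCModel

section LawOfLargeNumbers

variable {Θ Y : Type*} [MeasurableSpace Θ] [MetricSpace Y] [MeasurableSpace Y] [BorelSpace Y]
  (M : ABCModel Θ Y)

/-- The transition kernel of the chain of states and numbers of simulated pairs. -/
noncomputable def pairKernel : Kernel (Θ × ℕ∞) (Θ × ℕ∞) := M.oneHitStep.comap Prod.fst measurable_fst

instance : IsMarkovKernel M.pairKernel := by
  unfold pairKernel; infer_instance

instance : IsMarkovKernel M.oneHitKernel := by
  unfold oneHitKernel; infer_instance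

theorem oneHitChain_eq (ν : Measure Θ) :
    M.oneHitChain ν = M.pairKernel.pathKernel ∘ₘ (ν.map fun θ => (θ, 0)) := by
  rw [← Kernel.trajMeasure_homogeneous]
  rfl

/-- The next pair depends on the current one only through θ, whose marginal here is again the
posterior. -/
theorem invariant_pairKernel :
    M.pairKernel.Invariant (M.oneHitStep ∘ₘ M.posterior) := by
  have h := M.oneHitKernel_isReversible.invariant.def
  ext s hs
  have hm := Kernel.measurable_coe M.oneHitStep hs
  rw [Measure.bind_apply hs (Kernel.aemeasurable _), Measure.bind_apply hs (Kernel.aemeasurable _),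
    Measure.lintegral_bind (Kernel.aemeasurable _) (Kernel.measurable_coe _ hs).aemeasurable]
  conv_rhs => rw [← h, Measure.lintegral_bind (Kernel.aemeasurable _) hm.aemeasurable]
  refine lintegral_congr fun θ => ?_
  rw [oneHitKernel, Kernel.fst_apply, lintegral_map hm measurable_fst]
  rfl

theorem measurable_snd_toENNReal : Measurable fun x : Θ × ℕ∞ => (x.2 : ℝ≥0∞) :=
  (Measurable.of_discrete (f := fun n : ℕ∞ => (n : ℝ≥0∞))).comp measurable_snd

/-- The long-run expected number of simulated pairs per iteration. -/
noncomputable def meanCost : ℝ≥0∞ := ∫⁻ θ, ∫⁻ x, (x.2 : ℝ≥0∞) ∂M.oneHitStep θ ∂M.posterior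

theorem ergodic_shift [IsProbabilityMeasure M.prior] (hH : 0 < M.H)
    (hirr : IsIrreducibleOn M.posteriorSupport M.oneHitKernel) :
    Ergodic seqShift (M.pairKernel.pathKernel ∘ₘ (M.oneHitStep ∘ₘ M.posterior)) := by
  have := M.isProbabilityMeasure_posterior hH
  refine M.invariant_pairKernel.ergodic_shift fun u hu hu1 hharm => ?_
  set v : Θ → ℝ≥0∞ := fun θ => ∫⁻ x, u x ∂M.oneHitStep θ with hv
  -- A harmonic function of the pair chain depends on θ only, and as a function of θ it is harmonic
  -- for the 1-hit kernel.
  have huv : ∀ x, u x = v x.1 := hharm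
  have hvm : Measurable v := hu.lintegral_kernel
  have hv1 : ∀ θ, v θ ≤ 1 := fun θ => huv (θ, 0) ▸ hu1 _
  have hvh : ∀ θ, v θ = ∫⁻ ϑ, v ϑ ∂M.oneHitKernel θ := fun θ => by
    rw [oneHitKernel, Kernel.fst_apply, lintegral_map hvm measurable_fst]
    exact lintegral_congr huv
  obtain ⟨c, hc⟩ := M.oneHitKernel_isReversible.ae_eq_const_of_harmonic M.ae_posterior_mem_support
    hirr hvm hv1 hvh
  refine ⟨c, ?_⟩
  rw [← M.oneHitKernel_isReversible.invariant.def] at hc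
  have hms : MeasurableSet {x | u x = c} := hu (measurableSet_singleton c)
  rw [Measure.ae_comp_iff hms]
  filter_upwards [Measure.ae_ae_of_ae_comp hc] with θ hθ
  rw [oneHitKernel, Kernel.fst_apply] at hθ
  filter_upwards [ae_of_ae_map measurable_fst.aemeasurable hθ] with x hx
  rw [huv, hx]

/-- The paths along which the average number of simulated pairs converges to `n`. -/
def averageSet (Θ : Type*) (n : ℝ≥0∞) : Set (ℕ → Θ × ℕ∞) :=
  {ω | Tendsto (fun m : ℕ => (∑ i ∈ Finset.range m, ((ω i).2 : ℝ≥0∞)) / m) atTop (𝓝 n)}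

theorem measurableSet_averageSet (n : ℝ≥0∞) : MeasurableSet (averageSet Θ n) := by
  refine measurableSet_tendsto (𝓝 n) fun m => Measurable.div_const ?_ _
  exact Finset.measurable_fun_sum _ fun i _ =>
    measurable_snd_toENNReal.comp (measurable_pi_apply i)

theorem ae_mem_averageSet [IsProbabilityMeasure M.prior] (hH : 0 < M.H)
    (hirr : IsIrreducibleOn M.posteriorSupport M.oneHitKernel) :
    ∀ᵐ ω ∂(M.pairKernel.pathKernel ∘ₘ (M.oneHitStep ∘ₘ M.posterior)),
      ω ∈ averageSet Θ M.meanCost := by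
  have := M.isProbabilityMeasure_posterior hH
  have herg := M.ergodic_shift hH hirr
  set P := M.pairKernel.pathKernel ∘ₘ (M.oneHitStep ∘ₘ M.posterior) with hP
  have hfm : Measurable fun ω : ℕ → Θ × ℕ∞ => ((ω 0).2 : ℝ≥0∞) :=
    measurable_snd_toENNReal.comp (measurable_pi_apply 0)
  have hint : ∫⁻ ω, ((ω 0).2 : ℝ≥0∞) ∂P = M.meanCost := by
    rw [hP, Measure.lintegral_bind (Kernel.aemeasurable _) hfm.aemeasurable,
      Measure.lintegral_bind (Kernel.aemeasurable _) hfm.lintegral_kernel.aemeasurable, meanCost]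
    refine lintegral_congr fun θ => lintegral_congr fun x => ?_
    have h := Kernel.pathKernel_map_eval_zero M.pairKernel x
    rw [← lintegral_map (f := fun x : Θ × ℕ∞ => (x.2 : ℝ≥0∞)) (g := fun ω : ℕ → Θ × ℕ∞ => ω 0)
      measurable_snd_toENNReal (measurable_pi_apply 0), h, lintegral_dirac' _
      measurable_snd_toENNReal]
  have hfin : M.meanCost ≠ ∞ :=
    ne_top_of_le_ne_top (ENNReal.inv_ne_top.2 hH.ne') M.lintegral_pairs_posterior_le
  have hint' : ∫⁻ ω, ((ω 0).2 : ℝ≥0∞) ∂P ≠ ∞ := hint ▸ hfin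
  have h0 : ∀ᵐ ω ∂P, ((ω 0).2 : ℝ≥0∞) < ∞ := ae_lt_top hfm hint'
  -- Finiteness of all costs allows the passage between real Birkhoff averages and extended ones.
  have hall : ∀ᵐ ω ∂P, ∀ i : ℕ, ((ω i).2 : ℝ≥0∞) < ∞ := by
    refine ae_all_iff.2 fun i => ?_
    have := (herg.toMeasurePreserving.iterate i).quasiMeasurePreserving.ae h0
    filter_upwards [this] with ω hω
    simpa [iterate_seqShift_apply] using hω
  have hb := herg.ae_tendsto_birkhoffSum_div hfm.ennreal_toReal
    (integrable_toReal_of_lintegral_ne_top hfm.aemeasurable hint')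
  rw [integral_toReal hfm.aemeasurable h0, hint] at hb
  filter_upwards [hb, hall] with ω h1 h2
  refine (ENNReal.tendsto_toReal_iff (fun m => ?_) hfin).1 (h1.congr fun m => ?_)
  · rcases Nat.eq_zero_or_pos m with rfl | hm
    · simp
    · exact ENNReal.div_ne_top (ENNReal.sum_ne_top.2 fun i _ => (h2 i).ne)
        (by exact_mod_cast hm.ne')
  · rw [ENNReal.toReal_div, ENNReal.toReal_sum fun i _ => (h2 i).ne, ENNReal.toReal_natCast]
    simp [birkhoffSum, iterate_seqShift_apply]

/-- The probability that the average number of simulated pairs converges to `n`, as a function of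
the starting point of the algorithm. -/
noncomputable def averageProb (n : ℝ≥0∞) (θ : Θ) : ℝ≥0∞ :=
  ∫⁻ x, M.pairKernel.pathKernel x (averageSet Θ n) ∂M.oneHitStep θ

theorem measurable_averageProb (n : ℝ≥0∞) : Measurable (M.averageProb n) :=
  (Kernel.measurable_coe _ (measurableSet_averageSet n)).lintegral_kernel

theorem averageProb_le_one (n : ℝ≥0∞) (θ : Θ) : M.averageProb n θ ≤ 1 := by
  calc M.averageProb n θ ≤ ∫⁻ _, 1 ∂M.oneHitStep θ := lintegral_mono fun x => prob_le_one
    _ = 1 := by simp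

theorem ae_averageProb_eq_one [IsProbabilityMeasure M.prior] (hH : 0 < M.H)
    (hirr : IsIrreducibleOn M.posteriorSupport M.oneHitKernel) :
    ∀ᵐ θ ∂M.posterior, M.averageProb M.meanCost θ = 1 := by
  filter_upwards [Measure.ae_ae_of_ae_comp (Measure.ae_ae_of_ae_comp (M.ae_mem_averageSet hH hirr))]
    with θ hθ
  have : ∀ᵐ x ∂M.oneHitStep θ, M.pairKernel.pathKernel x (averageSet Θ M.meanCost) = 1 := by
    filter_upwards [hθ] with x hx
    exact (mem_ae_iff_prob_eq_one (measurableSet_averageSet _)).1 hx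
  rw [averageProb, lintegral_congr_ae this]
  simp

/-- `averageProb` is superharmonic on the support: there h(θ) > 0 makes the first cost a.s. finite,
so convergence of the averages from the second cost on implies convergence of all averages. -/
theorem lintegral_averageProb_le {n : ℝ≥0∞} (hn : n ≠ ∞) {θ : Θ} (hθ : θ ∈ M.posteriorSupport) :
    ∫⁻ ϑ, M.averageProb n ϑ ∂M.oneHitKernel θ ≤ M.averageProb n θ := by
  have hE := measurableSet_averageSet (Θ := Θ) n
  have hfin : ∀ᵐ x ∂M.oneHitStep θ, (x.2 : ℝ≥0∞) < ∞ := by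
    refine ae_lt_top measurable_snd_toENNReal ?_
    exact ne_top_of_le_ne_top (ENNReal.inv_ne_top.2 hθ.2.ne') (M.lintegral_pairs_oneHitStep_le θ)
  rw [oneHitKernel, Kernel.fst_apply, lintegral_map (M.measurable_averageProb n) measurable_fst]
  conv_rhs => rw [averageProb]
  refine lintegral_mono_ae ?_
  filter_upwards [hfin] with x hx
  have hA : MeasurableSet {x : Θ × ℕ∞ | (x.2 : ℝ≥0∞) < ∞} :=
    measurableSet_lt measurable_snd_toENNReal measurable_const
  have h := Kernel.pathKernel_inter_shift M.pairKernel x hA hE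
  rw [Set.indicator_of_mem (show x ∈ {x : Θ × ℕ∞ | (x.2 : ℝ≥0∞) < ∞} from hx)] at h
  calc M.averageProb n x.1
      = M.pairKernel.pathKernel x ({ω | ω 0 ∈ {x : Θ × ℕ∞ | (x.2 : ℝ≥0∞) < ∞}} ∩
          seqShift ⁻¹' averageSet Θ n) := h.symm
    _ ≤ _ := measure_mono fun ω hω =>
      ENNReal.tendsto_average_of_shift (a := fun i => ((ω i).2 : ℝ≥0∞))
        (show ((ω 0).2 : ℝ≥0∞) < ∞ from hω.1).ne hn hω.2

theorem averageProb_eq_one [MeasurableSingletonClass Θ] [IsProbabilityMeasure M.prior]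
    (hH : 0 < M.H) (hirr : IsIrreducibleOn M.posteriorSupport M.oneHitKernel) {θ : Θ}
    (hθ : θ ∈ M.posteriorSupport) : M.averageProb M.meanCost θ = 1 := by
  have := M.isProbabilityMeasure_posterior hH
  have hfin : M.meanCost ≠ ∞ :=
    ne_top_of_le_ne_top (ENNReal.inv_ne_top.2 hH.ne') M.lintegral_pairs_posterior_le
  have hae := M.ae_averageProb_eq_one hH hirr
  have hsum := M.lintegral_moveDensity_add_stayProb θ
  set U := M.averageProb M.meanCost with hU
  set K := ∫⁻ ϑ, M.moveDensity θ ϑ ∂M.base with hK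
  have hK1 : K ≤ 1 := hsum ▸ le_self_add
  -- K is the probability of an accepted move. If K = 0, the kernel at θ is the point mass, so the
  -- posterior sits at θ and the a.e. statement applies to θ itself.
  by_cases hK0 : K = 0
  · have hr : M.stayProb θ = 1 := by rwa [hK0, zero_add] at hsum
    have hk0 : ∀ᵐ ϑ ∂M.base, M.moveDensity θ ϑ = 0 :=
      (lintegral_eq_zero_iff (M.measurable_moveDensity.comp measurable_prodMk_left)).1 hK0
    have hdirac : M.oneHitKernel θ = Measure.dirac θ := by
      ext s hs
      have h := M.lintegral_oneHitKernel (measurable_one.indicator hs) θ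
      rw [lintegral_indicator_one hs] at h
      have h0 : ∫⁻ ϑ, M.moveDensity θ ϑ * s.indicator 1 ϑ ∂M.base = 0 := by
        rw [lintegral_congr_ae (g := fun _ => 0)]
        · simp
        · filter_upwards [hk0] with ϑ hϑ
          rw [hϑ, zero_mul]
      rw [h, h0, hr, zero_add, one_mul, Measure.dirac_apply' _ hs]
    have h1 := M.oneHitKernel_isReversible.measure_compl_singleton_eq_zero
      M.ae_posterior_mem_support hirr hθ hdirac
    have h2 : ∀ᵐ ϑ ∂M.posterior, ϑ = θ := by
      rw [ae_iff]; exact h1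
    obtain ⟨ϑ, h3, h4⟩ := (hae.and h2).exists
    rwa [h4] at h3
  -- Accepted moves reach only states with U = 1, so superharmonicity reads K + r·U(θ) ≤ U(θ) = (K +
  -- r)·U(θ) with r the holding probability. Cancelling r·U(θ) and then K gives 1 ≤ U(θ).
  · have hle := M.lintegral_averageProb_le hfin hθ
    rw [M.lintegral_oneHitKernel (M.measurable_averageProb _)] at hle
    have hH1 : M.H ≠ ∞ := ne_top_of_le_ne_top ENNReal.one_ne_top M.H_le_one
    have hmove : ∫⁻ ϑ, M.moveDensity θ ϑ * U ϑ ∂M.base = K := by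
      refine lintegral_congr_ae ?_
      filter_upwards [M.ae_moveDensity_eq_zero_or hH1 hae θ] with ϑ hϑ
      by_cases h : M.moveDensity θ ϑ = 0
      · rw [h, zero_mul]
      · rw [hϑ h, mul_one]
    rw [hmove] at hle
    have hU1 : U θ ≤ 1 := M.averageProb_le_one _ θ
    have hUeq : U θ = K * U θ + M.stayProb θ * U θ := by rw [← add_mul, hsum, one_mul]
    have hfinr : M.stayProb θ * U θ ≠ ∞ := by
      refine ne_top_of_le_ne_top ENNReal.one_ne_top (mul_le_one' ?_ hU1)
      rw [← hsum]; exact le_add_self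
    have h1 : K ≤ K * U θ := by
      have : K + M.stayProb θ * U θ ≤ K * U θ + M.stayProb θ * U θ := hle.trans_eq hUeq
      exact (ENNReal.add_le_add_iff_right hfinr).1 this
    refine hU1.antisymm ?_
    have h2 : K * 1 ≤ K * U θ := by rwa [mul_one]
    exact (ENNReal.mul_le_mul_iff_right hK0 (ne_top_of_le_ne_top ENNReal.one_ne_top hK1)).1 h2

theorem ae_oneHitChain_tendsto [MeasurableSingletonClass Θ] [IsProbabilityMeasure M.prior]
    (hH : 0 < M.H) (hirr : IsIrreducibleOn M.posteriorSupport M.oneHitKernel) (ν : Measure Θ)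
    (hν : ∀ᵐ θ ∂ν, θ ∈ M.posteriorSupport) :
    ∀ᵐ ω ∂(M.oneHitChain ν), Tendsto
      (fun m : ℕ => (∑ i ∈ Finset.Icc 1 m, ((ω i).2 : ℝ≥0∞)) / m) atTop (𝓝 M.meanCost) := by
  have hE := measurableSet_averageSet (Θ := Θ) M.meanCost
  have hE' := measurable_seqShift hE
  have hsum : ∀ ω : ℕ → Θ × ℕ∞, ω ∈ seqShift ⁻¹' averageSet Θ M.meanCost → Tendsto
      (fun m : ℕ => (∑ i ∈ Finset.Icc 1 m, ((ω i).2 : ℝ≥0∞)) / m) atTop (𝓝 M.meanCost) := by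
    intro ω hω
    refine Tendsto.congr (fun m => ?_) hω
    rw [Finset.range_eq_Ico, ← Finset.Ico_add_one_right_eq_Icc]
    simp only [seqShift]
    rw [Finset.sum_Ico_add' (fun i => ((ω i).2 : ℝ≥0∞)) 0 m 1, zero_add]
  -- The shift discards the artificial initial entry (θ₀, 0), so the averages start with N₁.
  suffices h : ∀ᵐ ω ∂(M.oneHitChain ν), ω ∈ seqShift ⁻¹' averageSet Θ M.meanCost from h.mono hsum
  rw [oneHitChain_eq, Measure.ae_comp_iff (p := fun ω => ω ∈ seqShift ⁻¹' averageSet Θ M.meanCost) hE']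
  have hm : Measurable fun θ : Θ => (θ, (0 : ℕ∞)) := measurable_prodMk_right
  have hms : MeasurableSet {x : Θ × ℕ∞ | ∀ᵐ ω ∂M.pairKernel.pathKernel x,
      ω ∈ seqShift ⁻¹' averageSet Θ M.meanCost} := by
    simp_rw [ae_iff]
    exact Kernel.measurable_coe _ hE'.compl (measurableSet_singleton 0)
  rw [ae_map_iff hm.aemeasurable hms]
  filter_upwards [hν] with θ hθ
  have h1 := M.averageProb_eq_one hH hirr hθ
  refine (mem_ae_iff_prob_eq_one hE').2 ?_
  rw [Kernel.pathKernel_shift_apply _ _ hE]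
  exact h1

end LawOfLargeNumbers

end ABCModel

theorem proposition3 {Θ Y : Type*} [MetricSpace Θ] [MeasurableSpace Θ] [BorelSpace Θ]
    [MetricSpace Y] [MeasurableSpace Y] [BorelSpace Y] (M : ABCModel Θ Y)
    [IsProbabilityMeasure M.prior] (hH : 0 < M.H)
    (hirr : IsIrreducibleOn M.posteriorSupport M.oneHitKernel) :
    ∃ n : ℝ≥0∞,
      (∀ ν : Measure Θ, IsProbabilityMeasure ν → (∀ᵐ θ ∂ν, θ ∈ M.posteriorSupport) →
        ∀ᵐ ω ∂(M.oneHitChain ν),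
          Tendsto (fun m : ℕ => (∑ i ∈ Finset.Icc 1 m, ((ω i).2 : ℝ≥0∞)) / m) atTop (𝓝 n)) ∧
      n ≤ M.H⁻¹ ∧ M.H⁻¹ < ∞ ∧ M.rejectionCost = M.H⁻¹ :=
  ⟨M.meanCost, fun ν _ hν => M.ae_oneHitChain_tendsto hH hirr ν hν,
    M.lintegral_pairs_posterior_le, ENNReal.inv_lt_top.2 hH, M.rejectionCost_eq⟩
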